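/- Let $G$ be a (finite-dimensional) Lie group with Lie algebra $\mathfrak g=T_1G$, let $K\subseteq G$ be a compact Lie subgroup with Lie algebra $\mathfrak k$, and let $M=G/K$ carry its quotient smooth structure, with projection $\pi:G\to M$. Let $G$ be equipped with a Riemannian metric that is invariant under all left translations and under right translations by elements of $K$, and let $\mathfrak k^\perp$ be the orthogonal complement of $\mathfrak k$ in $\mathfrak g$. Write $AC([0,1],N)$ for the set of absolutely continuous curves $[0,1]\to N$ in a manifold $N$. For $\alpha\in AC([0,1],G)$ let $$Q(\alpha)=(\alpha(0),q),\qquad q(t)=\begin{cases}L_{\alpha(t)^{-1}}\dfrac{\alpha'(t)}{\sqrt{\|\alpha'(t)\|}}&\alpha'(t)\ne0,\\ 0&\alpha'(t)=0.\end{cases}$$ Call $\alpha$ horizontal, $\alpha\in AC^\perp([0,1],G)$, if for almost every $t$ the vector $\alpha'(t)$ is orthogonal to $\ker d\pi_{\alpha(t)}$, and call $\alpha$ a horizontal lift of $\beta\in AC([0,1],M)$ if moreover $\pi\circ\alpha=\beta$. Then: 1. For every $\alpha\in AC([0,1],G)$ the function $q$ is in $L^2([0,1],\mathfrak g)$, so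 that $Q:AC([0,1],G)\to G\times L^2([0,1],\mathfrak g)$ is well defined; and $Q$ restricts to a bijection $AC^\perp([0,1],G)\to G\times L^2([0,1],\mathfrak k^\perp)$. 2. For every $\beta\in AC([0,1],M)$ and every $\alpha_0\in\pi^{-1}(\beta(0))$ there is exactly one horizontal lift $\alpha$ of $\beta$ with $\alpha(0)=\alpha_0$. 3. The formula $(\alpha_0,q)\ast y=(\alpha_0y,\;y^{-1}qy)$, where $y^{-1}qy=\mathrm{Ad}(y^{-1})q$, defines a right action of $K$ on $G\times L^2([0,1],\mathfrak k^\perp)$. If $\alpha,\tilde\alpha$ are horizontal lifts of the same $\beta\in AC([0,1],M)$, then $y:=\alpha(0)^{-1}\tilde\alpha(0)\in K$, $\tilde\alpha(t)=\alpha(t)\,y$ for all $t\in[0,1]$, and $Q(\tilde\alpha)=Q(\alpha)\ast y$. 4. $Q$ induces a bijection $$\bigl(G\times L^2([0,1],\mathfrak k^\perp)\bigr)/K\;\longrightarrow\;AC([0,1],M),\qquad [Q(\alpha)]\mapsto\pi\circ\alpha\quad(\alpha\in AC^\perp([0,1],G)).$$ -/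

import Mathlib

open Set MeasureTheory Manifold Bundle
open scoped ContDiff

noncomputable section

namespace HomSRV

/-! ### Absolutely continuous curves in a manifold -/

section Curves

variable (E : Type*) [NormedAddCommGroup E] [NormedSpace ℝ E]
  {N : Type*} [TopologicalSpace N] [ChartedSpace E N]

/-- A curve `γ : [0,1] → N` is absolutely continuous if it is continuous and, whenever it maps a
closed subinterval `[a,b]` into the domain of a chart, its expression in that chart is an absolutely
continuous function on `[a,b]` with values in the normed model space. -/
def IsAC (γ : unitInterval → N) : Prop :=
  Continuous γ ∧ ∀ (x : N) (a b : unitInterval), a ≤ b →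
    (∀ t ∈ Icc a b, γ t ∈ (chartAt E x).source) →
    AbsolutelyContinuousOnInterval
      (fun t : ℝ => chartAt E x (γ (projIcc 0 1 zero_le_one t))) (a : ℝ) (b : ℝ)

variable (N) in
/-- The set `AC([0,1], N)`. -/
def AC : Type _ := {γ : unitInterval → N // IsAC E γ}

variable {E}

instance : CoeFun (AC E N) (fun _ => unitInterval → N) := ⟨Subtype.val⟩

/-- The extension of a curve on `[0,1]` to `ℝ`, constant on both sides of `[0,1]`; it is used only
to express the derivative at interior points. -/
def AC.ext (γ : AC E N) (t : ℝ) : N := γ (projIcc 0 1 zero_le_one t)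

/-- The velocity `γ'(t) ∈ T_{γ(t)} N`, which exists for almost every `t ∈ [0,1]`. -/
def AC.velocity (γ : AC E N) (t : ℝ) : TangentSpace 𝓘(ℝ, E) (γ.ext t) :=
  mfderiv 𝓘(ℝ, ℝ) 𝓘(ℝ, E) γ.ext t (1 : ℝ)

end Curves

/-- Lebesgue measure on `[0,1]`. -/
abbrev lebI : Measure ℝ := volume.restrict (Icc (0 : ℝ) 1)

section Group

variable {E : Type*} [NormedAddCommGroup E] [NormedSpace ℝ E]
  {G : Type*} [TopologicalSpace G] [ChartedSpace E G] [Group G]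

/-- The differential at `h` of the left translation by `g`. -/
def dL (g h : G) : TangentSpace 𝓘(ℝ, E) h →L[ℝ] TangentSpace 𝓘(ℝ, E) (g * h) :=
  mfderiv 𝓘(ℝ, E) 𝓘(ℝ, E) (fun x : G => g * x) h

/-- The differential at `h` of the right translation by `g`. -/
def dR (g h : G) : TangentSpace 𝓘(ℝ, E) h →L[ℝ] TangentSpace 𝓘(ℝ, E) (h * g) :=
  mfderiv 𝓘(ℝ, E) 𝓘(ℝ, E) (fun x : G => x * g) h

/-- Left translation `v ↦ L_{g⁻¹} v` of tangent vectors at `g` to the Lie algebra `𝔤 = T₁G`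
(using `g⁻¹ * g = 1`). -/
def toLieAlgebra (g : G) : TangentSpace 𝓘(ℝ, E) g →L[ℝ] TangentSpace 𝓘(ℝ, E) (1 : G) :=
  mfderiv 𝓘(ℝ, E) 𝓘(ℝ, E) (fun x : G => g⁻¹ * x) g

/-- The adjoint action `X ↦ y X y⁻¹` on the Lie algebra (using `y * 1 * y⁻¹ = 1`). -/
def Ad (y : G) : TangentSpace 𝓘(ℝ, E) (1 : G) →L[ℝ] TangentSpace 𝓘(ℝ, E) (1 : G) :=
  mfderiv 𝓘(ℝ, E) 𝓘(ℝ, E) (fun x : G => y * x * y⁻¹) 1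

/-- The velocity at time `0` of a curve in `G` that passes through `1` at time `0`. -/
def velocityAtOne (c : ℝ → G) : TangentSpace 𝓘(ℝ, E) (1 : G) :=
  mfderiv 𝓘(ℝ, ℝ) 𝓘(ℝ, E) c 0 (1 : ℝ)

theorem mfderiv_mul_one [LieGroup 𝓘(ℝ, E) ∞ G]
    (u : TangentSpace (𝓘(ℝ, E).prod 𝓘(ℝ, E)) ((1, 1) : G × G)) :
    (mfderiv (𝓘(ℝ, E).prod 𝓘(ℝ, E)) 𝓘(ℝ, E) (fun p : G × G => p.1 * p.2) (1, 1) u : E) =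
      (u.1 : E) + (u.2 : E) := by
  have h : MDifferentiableAt (𝓘(ℝ, E).prod 𝓘(ℝ, E)) 𝓘(ℝ, E) (fun p : G × G => p.1 * p.2) (1, 1) :=
    ((contMDiff_mul 𝓘(ℝ, E) ∞).mdifferentiable (by simp)) _
  have e1 : (mfderiv 𝓘(ℝ, E) 𝓘(ℝ, E) (fun z : G => z * 1) 1 : E →L[ℝ] E)
      = ContinuousLinearMap.id ℝ E := by
    have : (fun z : G => z * 1) = id := by ext; simp
    rw [this]; exact mfderiv_id
  have e2 : (mfderiv 𝓘(ℝ, E) 𝓘(ℝ, E) (fun z : G => 1 * z) 1 : E →L[ℝ] E)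
      = ContinuousLinearMap.id ℝ E := by
    have : (fun z : G => 1 * z) = id := by ext; simp
    rw [this]; exact mfderiv_id
  refine (mfderiv_prod_eq_add_apply h).trans ?_
  exact congrArg₂ (fun (A B : E →L[ℝ] E) => A u.1 + B u.2) e1 e2

theorem velocityAtOne_mul [LieGroup 𝓘(ℝ, E) ∞ G] {c d : ℝ → G}
    (hc : ContMDiff 𝓘(ℝ, ℝ) 𝓘(ℝ, E) ∞ c) (hd : ContMDiff 𝓘(ℝ, ℝ) 𝓘(ℝ, E) ∞ d)
    (hc0 : c 0 = 1) (hd0 : d 0 = 1) :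
    velocityAtOne (E := E) (fun t => c t * d t) = velocityAtOne c + velocityAtOne d := by
  have h1 := (hc.mdifferentiable (by simp) 0).hasMFDerivAt
  have h2 := (hd.mdifferentiable (by simp) 0).hasMFDerivAt
  have h3 := h1.prodMk h2
  have h4 : MDifferentiableAt (𝓘(ℝ, E).prod 𝓘(ℝ, E)) 𝓘(ℝ, E)
      (fun p : G × G => p.1 * p.2) (c 0, d 0) :=
    ((contMDiff_mul 𝓘(ℝ, E) ∞).mdifferentiable (by simp)) _
  have h5 := (h4.hasMFDerivAt.comp 0 h3).mfderiv
  have h6 : ∀ p : G × G, p = (1, 1) → ∀ u : E × E,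
      (mfderiv (𝓘(ℝ, E).prod 𝓘(ℝ, E)) 𝓘(ℝ, E) (fun p : G × G => p.1 * p.2) p : E × E →L[ℝ] E) u =
        u.1 + u.2 := by
    rintro p rfl u; exact mfderiv_mul_one u
  exact (congrArg (fun A : ℝ →L[ℝ] E => A 1) h5).trans (h6 (c 0, d 0) (by rw [hc0, hd0]) _)

theorem velocityAtOne_comp_mul {c : ℝ → G} [LieGroup 𝓘(ℝ, E) ∞ G]
    (hc : ContMDiff 𝓘(ℝ, ℝ) 𝓘(ℝ, E) ∞ c) (r : ℝ) :
    velocityAtOne (E := E) (fun t => c (r * t)) = r • velocityAtOne c := by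
  have h2 : HasMFDerivAt 𝓘(ℝ, ℝ) 𝓘(ℝ, ℝ) (fun t : ℝ => r * t) 0
      (r • ContinuousLinearMap.id ℝ ℝ) :=
    ((hasFDerivAt_id (𝕜 := ℝ) (0 : ℝ)).const_mul r).hasMFDerivAt
  have h1 : ∀ s : ℝ, s = 0 → HasMFDerivAt 𝓘(ℝ, ℝ) 𝓘(ℝ, E) c s
      (mfderiv 𝓘(ℝ, ℝ) 𝓘(ℝ, E) c 0 : ℝ →L[ℝ] E) := by
    rintro s rfl; exact (hc.mdifferentiable (by simp) 0).hasMFDerivAt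
  have h5 := ((h1 (r * 0) (by simp)).comp 0 h2).mfderiv
  refine (congrArg (fun A : ℝ →L[ℝ] E => A 1) h5).trans ?_
  have h7 : ∀ A : ℝ →L[ℝ] E, A (r • (1 : ℝ)) = r • A 1 := fun A => A.map_smul r 1
  exact h7 _

/-- The Lie algebra `𝔨 ⊆ 𝔤` of the closed subgroup `K`, i.e. the tangent space of `K` at `1`: the
velocities at `1` of smooth curves in `G` that lie in `K`. -/
def lieAlg [LieGroup 𝓘(ℝ, E) ∞ G] (K : Subgroup G) :
    Submodule ℝ (TangentSpace 𝓘(ℝ, E) (1 : G)) where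
  carrier := {X | ∃ c : ℝ → G, ContMDiff 𝓘(ℝ, ℝ) 𝓘(ℝ, E) ∞ c ∧ (∀ t, c t ∈ K) ∧ c 0 = 1 ∧
    velocityAtOne c = X}
  zero_mem' := ⟨fun _ => 1, contMDiff_const, fun _ => K.one_mem, rfl, by
    exact congrArg (fun A : ℝ →L[ℝ] E => A 1)
      (mfderiv_const (I := 𝓘(ℝ, ℝ)) (I' := 𝓘(ℝ, E)) (x := (0 : ℝ)) (c := (1 : G)))⟩
  add_mem' := by
    rintro X Y ⟨c, hc, hcK, hc0, rfl⟩ ⟨d, hd, hdK, hd0, rfl⟩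
    exact ⟨fun t => c t * d t, hc.mul hd, fun t => K.mul_mem (hcK t) (hdK t), by simp [hc0, hd0],
      velocityAtOne_mul hc hd hc0 hd0⟩
  smul_mem' := by
    rintro r X ⟨c, hc, hcK, hc0, rfl⟩
    have hr : ContMDiff 𝓘(ℝ, ℝ) 𝓘(ℝ, ℝ) ∞ (fun t : ℝ => r * t) :=
      (contDiff_const.mul contDiff_id).contMDiff
    exact ⟨fun t => c (r * t), hc.comp hr, fun t => hcK _, by simp [hc0],
      velocityAtOne_comp_mul hc r⟩

end Group

section Metric

variable {E : Type*} [NormedAddCommGroup E] [NormedSpace ℝ E]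
  {G : Type*} [TopologicalSpace G] [ChartedSpace E G] [Group G] [LieGroup 𝓘(ℝ, E) ∞ G]
  [RiemannianBundle (fun g : G => TangentSpace 𝓘(ℝ, E) g)]

variable (E G) in
/-- The space `L²([0,1], 𝔤)`, where `𝔤 = T₁G` carries the inner product given by the metric. -/
abbrev L2 : Type _ := Lp (TangentSpace 𝓘(ℝ, E) (1 : G)) 2 lebI

variable (E) in
/-- The space `L²([0,1], 𝔨^⊥)`, as a subspace of `L²([0,1], 𝔤)`. -/
def L2perp (K : Subgroup G) : Submodule ℝ (L2 E G) where
  carrier := {q | ∀ᵐ t ∂lebI, q t ∈ (lieAlg (E := E) K)ᗮ}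
  zero_mem' := by
    filter_upwards [Lp.coeFn_zero (TangentSpace 𝓘(ℝ, E) (1 : G)) 2 lebI] with t ht
    rw [ht]; exact Submodule.zero_mem _
  add_mem' := by
    intro p q hp hq
    filter_upwards [hp, hq, Lp.coeFn_add p q] with t h1 h2 h3
    rw [h3]; exact Submodule.add_mem _ h1 h2
  smul_mem' := by
    intro r p hp
    filter_upwards [hp, Lp.coeFn_smul r p] with t h1 h3
    rw [h3]; exact Submodule.smul_mem _ r h1

open Classical in
/-- The function `q(t) = L_{α(t)⁻¹} (α'(t) / √‖α'(t)‖)`, and `q(t) = 0` where `α'(t) = 0`. -/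
def srv (α : AC E G) (t : ℝ) : TangentSpace 𝓘(ℝ, E) (1 : G) :=
  if α.velocity t = 0 then 0
  else toLieAlgebra (α.ext t) ((√‖α.velocity t‖)⁻¹ • α.velocity t)

open Classical in
/-- The map `Q(α) = (α(0), q)` from `AC([0,1], G)` to `G × L²([0,1], 𝔤)`. (The value `0` for a
function that is not square integrable is never used: part of the theorem is that `q` is square
integrable for every absolutely continuous `α`.) -/
def Q (α : AC E G) : G × L2 E G :=
  (α 0, if h : MemLp (srv α) 2 lebI then h.toLp (srv α) else 0)

/-- The right action `(α₀, q) ∗ y = (α₀ y, y⁻¹ q y)` on `G × L²([0,1], 𝔤)`. -/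
def act (p : G × L2 E G) (y : G) : G × L2 E G :=
  (p.1 * y, (Ad (E := E) y⁻¹).compLp p.2)

/-- The quotient `(G × L²([0,1], 𝔨^⊥)) / K`. -/
def QuotientByK (E : Type*) [NormedAddCommGroup E] [NormedSpace ℝ E]
    {G : Type*} [TopologicalSpace G] [ChartedSpace E G] [Group G] [LieGroup 𝓘(ℝ, E) ∞ G]
    [RiemannianBundle (fun g : G => TangentSpace 𝓘(ℝ, E) g)] (K : Subgroup G) : Type _ :=
  Quot (fun p p' : G × L2perp E K => ∃ y ∈ K, ((p'.1, (p'.2 : L2 E G)) = act (p.1, (p.2 : L2 E G)) y))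

variable (E G) in
/-- The Riemannian metric on `G` is invariant under all left translations. -/
def MetricLeftInvariant : Prop :=
  ∀ (g h : G) (v w : TangentSpace 𝓘(ℝ, E) h), inner ℝ (dL g h v) (dL g h w) = inner ℝ v w

variable (E) in
/-- The Riemannian metric on `G` is invariant under right translations by elements of `K`. -/
def MetricRightInvariant (K : Subgroup G) : Prop :=
  ∀ y ∈ K, ∀ (h : G) (v w : TangentSpace 𝓘(ℝ, E) h), inner ℝ (dR y h v) (dR y h w) = inner ℝ v w

variable (F : Type*) [NormedAddCommGroup F] [NormedSpace ℝ F]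

variable (E) in
/-- The vertical space `V_p = ker (dπ_p)` at `p ∈ G`, where `π : G → G/K` is the quotient map; it is
the tangent space at `p` of the coset `pK`. -/
def vertical (K : Subgroup G) [ChartedSpace F (G ⧸ K)] (p : G) :
    Submodule ℝ (TangentSpace 𝓘(ℝ, E) p) :=
  (mfderiv 𝓘(ℝ, E) 𝓘(ℝ, F) (QuotientGroup.mk : G → G ⧸ K) p).ker

/-- The curve `α` is horizontal, i.e. belongs to `AC^⊥([0,1], G)`: for almost every `t` its velocity
lies in the orthogonal complement `H_{α(t)}` of the vertical space in `T_{α(t)} G`. -/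
def IsHorizontal (K : Subgroup G) [ChartedSpace F (G ⧸ K)] (α : AC E G) : Prop :=
  ∀ᵐ t ∂lebI, α.velocity t ∈ (vertical E F K (α.ext t))ᗮ

/-- `α` is a horizontal lift of the curve `β` in `M = G/K`. -/
def IsHorizontalLift (K : Subgroup G) [ChartedSpace F (G ⧸ K)] (α : AC E G) (β : AC F (G ⧸ K)) :
    Prop :=
  IsHorizontal F K α ∧ ∀ t, (QuotientGroup.mk (α t) : G ⧸ K) = β t

end Metric

end HomSRV

end

open Set MeasureTheory Manifold Bundle
open scoped ContDiff

noncomputable section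

set_option linter.unusedSectionVars false

/-! Left translation trivializes the tangent bundle, so an absolutely continuous curve α in G is
encoded by α(0) and its logarithmic derivative w = α⁻¹α', an integrable function with values in 𝔤.
Left invariance gives ‖α'‖ = ‖w‖, so q = w/√‖w‖ and conversely w = ‖q‖q. Since ‖q‖² = ‖w‖, square
integrable q correspond exactly to integrable w. Bijectivity of Q is therefore unique solvability of
m⁻¹m' = w with given initial value. Uniqueness (`LocAC.eq_of_logDeriv_eq`): if a and b are
solutions, ab⁻¹ has zero velocity almost everywhere and so is constant. Existence
(`exists_locAC_of_logDeriv`): a contraction argument in the chart at 1 handles small ∫‖w‖, and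
products of such solutions handle the general case.

The kernel of dπ at p is the left translate of 𝔨 (`tmap_mk_eq_zero_iff`), so α is horizontal iff w,
equivalently q, lies in 𝔨^⊥ almost everywhere. The two invariances of the metric make Ad(y), y ∈ K,
an isometry preserving 𝔨 and hence 𝔨^⊥.

To lift β horizontally, local sections of the submersion π are glued to some lift a (`exists_lift`).
With P the projection onto 𝔨 along 𝔨^⊥, the solution m of m⁻¹m' = P(a⁻¹a') stays in K, and am⁻¹ has
logarithmic derivative Ad(m)(1 - P)(a⁻¹a') in 𝔨^⊥. If a and b are two horizontal lifts, a⁻¹b runs in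
K and its logarithmic derivative lies in both 𝔨 and 𝔨^⊥, so a⁻¹b is constant. Right multiplication
by y turns w into Ad(y⁻¹)w, which is the action ∗; the bijection from the quotient by K combines
these facts. -/

namespace HomSRV

open Filter Topology

/-! ### Absolutely continuous functions into metric spaces -/

section RealAC

open AbsolutelyContinuousOnInterval

variable {X : Type*} [PseudoMetricSpace X]

/-- Absolute continuity is preserved by a reparametrization that is monotone and `1`-Lipschitz. -/
theorem ac_comp_monotone {u : ℝ → X} {g : ℝ → ℝ} {a b c d : ℝ}
    (hu : AbsolutelyContinuousOnInterval u a b) (hg : Monotone g)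
    (hg1 : ∀ x y, dist (g x) (g y) ≤ dist x y) (hm : MapsTo g (uIcc c d) (uIcc a b)) :
    AbsolutelyContinuousOnInterval (fun t => u (g t)) c d := by
  rw [absolutelyContinuousOnInterval_iff] at hu ⊢
  intro ε hε
  obtain ⟨δ, hδ, h⟩ := hu ε hε
  refine ⟨δ, hδ, fun I hI hI' => ?_⟩
  refine h (I.1, fun i => (g (I.2 i).1, g (I.2 i).2)) ⟨fun i hi => ?_, fun i hi j hj hij => ?_⟩
    ((Finset.sum_le_sum fun i _ => hg1 _ _).trans_lt hI')
  · exact ⟨hm (hI.1 i hi).1, hm (hI.1 i hi).2⟩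
  · have hd := hI.2 hi hj hij
    simp only [Function.onFun] at hd ⊢
    generalize (I.2 i).1 = x at *
    generalize (I.2 i).2 = y at *
    generalize (I.2 j).1 = x' at *
    generalize (I.2 j).2 = y' at *
    -- Disjointness of half-open intervals is an inequality between minima and maxima of endpoints,
    -- and a monotone map preserves it.
    have e : ∀ p q : ℝ, uIoc (g p) (g q) = Ioc (g (min p q)) (g (max p q)) := by
      intro p q; simp [uIoc, hg.map_min, hg.map_max]
    rw [e, e, Set.Ioc_disjoint_Ioc]
    rw [uIoc, uIoc, Set.Ioc_disjoint_Ioc] at hd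
    rw [← hg.map_min, ← hg.map_max]
    exact hg hd

/-- The common comparison principle: the oscillation sums of `u` are at most `K` times those of `v`,
which tend to zero. -/
theorem ac_of_dist_le {Y : Type*} [PseudoMetricSpace Y] {u : ℝ → X} {v : ℝ → Y} {a b : ℝ}
    (K : ℝ) (hv : AbsolutelyContinuousOnInterval v a b)
    (h : ∀ x ∈ uIcc a b, ∀ y ∈ uIcc a b, dist (u x) (u y) ≤ K * dist (v x) (v y)) :
    AbsolutelyContinuousOnInterval u a b := by
  refine squeeze_zero' (.of_forall fun _ => Finset.sum_nonneg fun _ _ => dist_nonneg) ?_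
    (by simpa using Tendsto.const_mul K hv)
  filter_upwards [eventually_inf_principal.mpr (Eventually.of_forall fun _ h => h)] with I hI
  rw [Finset.mul_sum]
  exact Finset.sum_le_sum fun i hi => h _ (hI.1 i hi).1 _ (hI.1 i hi).2

theorem ac_congr {u v : ℝ → X} {a b : ℝ} (hu : AbsolutelyContinuousOnInterval u a b)
    (h : EqOn v u (uIcc a b)) : AbsolutelyContinuousOnInterval v a b :=
  ac_of_dist_le 1 hu fun x hx y hy => by rw [h hx, h hy, one_mul]

theorem ac_lipschitz_comp {Y : Type*} [PseudoMetricSpace Y] {u : ℝ → X} {f : X → Y} {a b : ℝ}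
    {K : NNReal} {s : Set X} (hu : AbsolutelyContinuousOnInterval u a b) (hf : LipschitzOnWith K f s)
    (hs : MapsTo u (uIcc a b) s) : AbsolutelyContinuousOnInterval (fun t => f (u t)) a b :=
  ac_of_dist_le K hu fun _ hx _ hy => hf.dist_le_mul _ (hs hx) _ (hs hy)

theorem ac_prodMk {Y : Type*} [PseudoMetricSpace Y] {u : ℝ → X} {v : ℝ → Y} {a b : ℝ}
    (hu : AbsolutelyContinuousOnInterval u a b) (hv : AbsolutelyContinuousOnInterval v a b) :
    AbsolutelyContinuousOnInterval (fun t => (u t, v t)) a b := by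
  refine squeeze_zero (fun _ => Finset.sum_nonneg fun _ _ => dist_nonneg) (fun I => ?_)
    (by simpa using Tendsto.add hu hv)
  rw [← Finset.sum_add_distrib]
  refine Finset.sum_le_sum fun i _ => ?_
  rw [Prod.dist_eq]
  exact max_le_add_of_nonneg dist_nonneg dist_nonneg

end RealAC

/-! ### Absolutely continuous functions into normed spaces -/

section Vector

variable {E : Type*} [NormedAddCommGroup E]

theorem ac_const (c : E) (a b : ℝ) : AbsolutelyContinuousOnInterval (fun _ => c) a b :=
  (LipschitzWith.const c).lipschitzOnWith.absolutelyContinuousOnInterval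

theorem dist_min_le (c x y : ℝ) : dist (min x c) (min y c) ≤ dist x y := by
  have := abs_min_sub_min_le_max x c y c
  simpa [Real.dist_eq] using this

theorem dist_max_le (c x y : ℝ) : dist (max x c) (max y c) ≤ dist x y := by
  have := abs_max_sub_max_le_max x c y c
  simpa [Real.dist_eq] using this

/-- Gluing without splitting intervals: u(t) = u(min t b) + u(max t b) - u(b), and both
reparametrizations are monotone and 1-Lipschitz. -/
theorem ac_trans {u : ℝ → E} {a b c : ℝ} (hab : a ≤ b) (hbc : b ≤ c)
    (h1 : AbsolutelyContinuousOnInterval u a b) (h2 : AbsolutelyContinuousOnInterval u b c) :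
    AbsolutelyContinuousOnInterval u a c := by
  have k1 : AbsolutelyContinuousOnInterval (fun t => u (min t b)) a c :=
    ac_comp_monotone h1 (fun x y h => min_le_min_right b h) (dist_min_le b) (by
      rw [uIcc_of_le hab, uIcc_of_le (hab.trans hbc)]
      exact fun x hx => ⟨le_min hx.1 hab, min_le_right _ _⟩)
  have k2 : AbsolutelyContinuousOnInterval (fun t => u (max t b)) a c :=
    ac_comp_monotone h2 (fun x y h => max_le_max_right b h) (dist_max_le b) (by
      rw [uIcc_of_le hbc, uIcc_of_le (hab.trans hbc)]
      exact fun x hx => ⟨le_max_right _ _, max_le hx.2 hbc⟩)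
  refine ac_congr ((k1.add k2).sub (ac_const (u b) a c)) fun t _ => ?_
  rcases le_total t b with h | h <;> simp [h]

/-- By compactness a finite subdivision has each piece inside one good neighbourhood; the pieces are
joined by `ac_trans`. -/
theorem ac_of_locally {u : ℝ → E} {a b : ℝ} (hab : a ≤ b)
    (h : ∀ t ∈ Icc a b, ∃ ε > 0, AbsolutelyContinuousOnInterval u (t - ε) (t + ε)) :
    AbsolutelyContinuousOnInterval u a b := by
  choose! ε hε hac using h
  obtain ⟨t, ht0, htm, ⟨m, hm⟩, ht⟩ := exists_monotone_Icc_subset_open_cover_Icc hab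
    (c := fun s : Icc a b => (Subtype.val ⁻¹' Ioo ((s : ℝ) - ε s) (s + ε s) : Set (Icc a b)))
    (fun s => isOpen_Ioo.preimage continuous_subtype_val)
    (fun s _ => mem_iUnion.2 ⟨s, by have := hε s s.2; constructor <;> linarith⟩)
  have key : ∀ n, AbsolutelyContinuousOnInterval u a (t n) := by
    intro n
    induction n with
    | zero =>
      rw [ht0]
      exact ac_congr (ac_const (u a) a a) (by simp [EqOn])
    | succ n ih =>
      obtain ⟨s, hs⟩ := ht n
      have hle : t n ≤ t (n + 1) := htm (Nat.le_succ n)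
      refine ac_trans (t n).2.1 hle ih ((hac s s.2).mono ?_)
      have h1 := hs ⟨le_rfl, hle⟩
      have h2 := hs ⟨hle, le_rfl⟩
      simp only [mem_preimage, mem_Ioo] at h1 h2
      have := hε s s.2
      rw [uIcc_of_le (by exact hle), uIcc_of_le (by linarith)]
      exact Icc_subset_Icc h1.1.le h2.2.le
  have := key m
  rwa [hm m le_rfl] at this

variable [NormedSpace ℝ E]

/-- Increments of the primitive are bounded by those of the real primitive of ‖w‖, which reduces the
claim to scalar integrands. -/
theorem ac_integral {w : ℝ → E} {a b c : ℝ} (h : ∀ x y, IntervalIntegrable w volume x y) :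
    AbsolutelyContinuousOnInterval (fun x => ∫ s in c..x, w s) a b := by
  have h1 := (h (min a c) (max b c)).norm
  have h2 : AbsolutelyContinuousOnInterval (fun x => ∫ s in a..x, ‖w s‖) a b :=
    (h a b).norm.absolutelyContinuousOnInterval_intervalIntegral (by simp)
  refine ac_of_dist_le 1 h2 fun x _ y _ => ?_
  rw [one_mul, dist_eq_norm, dist_eq_norm,
    intervalIntegral.integral_interval_sub_left (h _ _) (h _ _),
    intervalIntegral.integral_interval_sub_left (h _ _).norm (h _ _).norm]
  exact intervalIntegral.norm_integral_le_abs_integral_norm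

variable [FiniteDimensional ℝ E]

/-- Reduces to the scalar case in a basis. Bounded variation gives differentiability almost
everywhere, so the derivative is the sum of the coordinate derivatives. -/
theorem ac_intervalIntegrable_deriv {u : ℝ → E} {a b : ℝ}
    (hu : AbsolutelyContinuousOnInterval u a b) : IntervalIntegrable (deriv u) volume a b := by
  let e := Module.finBasis ℝ E
  have hc : ∀ i, IntervalIntegrable (fun t => deriv (fun s => e.coord i (u s)) t • e i)
      volume a b := fun i => by
    have : AbsolutelyContinuousOnInterval (fun s => e.coord i (u s)) a b :=
      ac_lipschitz_comp hu (LinearMap.toContinuousLinearMap (e.coord i)).lipschitz.lipschitzOnWith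
        (mapsTo_univ _ _)
    have h := this.intervalIntegrable_deriv
    exact ⟨h.1.smul_const _, h.2.smul_const _⟩
  have hd := hu.boundedVariationOn.ae_differentiableAt_of_mem_uIcc
  refine (IntervalIntegrable.sum Finset.univ fun i _ => hc i).congr_ae ?_
  rw [Filter.EventuallyEq, ae_restrict_iff' (by simp [uIoc])]
  filter_upwards [hd] with t ht htm
  have h1 := (ht (uIoc_subset_uIcc htm)).hasDerivAt
  have h2 : ∀ i, deriv (fun s => e.coord i (u s)) t = e.coord i (deriv u t) := fun i =>
    ((LinearMap.toContinuousLinearMap (e.coord i)).hasFDerivAt.comp_hasDerivAt t h1).deriv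
  simp only [Finset.sum_apply, h2]
  exact e.sum_repr (deriv u t)

end Vector

/-! ### Locally absolutely continuous curves in manifolds -/

section LocallyAC

variable {E : Type*} [NormedAddCommGroup E] [NormedSpace ℝ E]
  {N : Type*} [TopologicalSpace N] [ChartedSpace E N]
  {E₁ : Type*} [NormedAddCommGroup E₁] [NormedSpace ℝ E₁]
  {N₁ : Type*} [TopologicalSpace N₁] [ChartedSpace E₁ N₁]
  {E₂ : Type*} [NormedAddCommGroup E₂] [NormedSpace ℝ E₂]
  {N₂ : Type*} [TopologicalSpace N₂] [ChartedSpace E₂ N₂]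

variable (E) in
/-- A curve `γ : ℝ → N` is absolutely continuous near `t` in the preferred chart at `γ t`. -/
def ACAt (γ : ℝ → N) (t : ℝ) : Prop :=
  ∃ ε > 0, AbsolutelyContinuousOnInterval (fun s => chartAt E (γ t) (γ s)) (t - ε) (t + ε)

variable (E) in
/-- Continuous curves `γ : ℝ → N` that are locally absolutely continuous. -/
def LocAC (γ : ℝ → N) : Prop := Continuous γ ∧ ∀ t, ACAt E γ t

theorem exists_uIcc_subset {s : Set ℝ} {t ε : ℝ} (hε : 0 < ε) (hs : s ∈ 𝓝 t) :
    ∃ δ > 0, δ ≤ ε ∧ uIcc (t - δ) (t + δ) ⊆ s := by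
  obtain ⟨δ, hδ, h⟩ := Metric.nhds_basis_closedBall.mem_iff.1 hs
  refine ⟨min δ ε, lt_min hδ hε, min_le_right _ _, ?_⟩
  rw [uIcc_of_le (by have := lt_min hδ hε; linarith), ← Real.closedBall_eq_Icc]
  exact (Metric.closedBall_subset_closedBall (min_le_left _ _)).trans h

theorem uIcc_shrink {t δ ε : ℝ} (hδ : 0 < δ) (h : δ ≤ ε) :
    uIcc (t - δ) (t + δ) ⊆ uIcc (t - ε) (t + ε) := by
  rw [uIcc_of_le (by linarith), uIcc_of_le (by linarith)]
  exact Icc_subset_Icc (by linarith) (by linarith)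

/-- In charts a C¹ map is locally Lipschitz, and Lipschitz maps preserve absolute continuity. Two
arguments are allowed so that group multiplication is covered. -/
theorem ACAt.comp₂ {γ₁ : ℝ → N₁} {γ₂ : ℝ → N₂} {f : N₁ × N₂ → N} {t : ℝ}
    (h₁ : ACAt E₁ γ₁ t) (h₂ : ACAt E₂ γ₂ t) (c₁ : ContinuousAt γ₁ t) (c₂ : ContinuousAt γ₂ t)
    (hf : ContMDiffAt (𝓘(ℝ, E₁).prod 𝓘(ℝ, E₂)) 𝓘(ℝ, E) 1 f (γ₁ t, γ₂ t)) :
    ACAt E (fun s => f (γ₁ s, γ₂ s)) t := by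
  obtain ⟨ε₁, hε₁, a₁⟩ := h₁
  obtain ⟨ε₂, hε₂, a₂⟩ := h₂
  have hF := (contMDiffAt_iff.1 hf).2
  have hr : range (𝓘(ℝ, E₁).prod 𝓘(ℝ, E₂)) = univ := by simp
  rw [hr, contDiffWithinAt_univ] at hF
  obtain ⟨K, V, hV, hK⟩ := hF.exists_lipschitzOnWith
  set u : ℝ → E₁ × E₂ := fun s => (chartAt E₁ (γ₁ t) (γ₁ s), chartAt E₂ (γ₂ t) (γ₂ s)) with hu
  have hu0 : ContinuousAt u t := by
    refine ContinuousAt.prodMk ?_ ?_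
    · exact ContinuousAt.comp
        ((chartAt E₁ (γ₁ t)).continuousAt (mem_chart_source E₁ (γ₁ t))) c₁
    · exact ContinuousAt.comp
        ((chartAt E₂ (γ₂ t)).continuousAt (mem_chart_source E₂ (γ₂ t))) c₂
  have hV' : u ⁻¹' V ∈ 𝓝 t := hu0 (by simpa [hu] using hV)
  have s₁ : γ₁ ⁻¹' (chartAt E₁ (γ₁ t)).source ∈ 𝓝 t := c₁ (chart_source_mem_nhds _ _)
  have s₂ : γ₂ ⁻¹' (chartAt E₂ (γ₂ t)).source ∈ 𝓝 t := c₂ (chart_source_mem_nhds _ _)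
  obtain ⟨δ, hδ, hle, hsub⟩ := exists_uIcc_subset (lt_min hε₁ hε₂)
    (inter_mem hV' (inter_mem s₁ s₂))
  refine ⟨δ, hδ, ?_⟩
  have ha := ac_prodMk (a₁.mono (uIcc_shrink hδ (hle.trans (min_le_left _ _))))
    (a₂.mono (uIcc_shrink hδ (hle.trans (min_le_right _ _))))
  refine ac_congr (ac_lipschitz_comp ha hK fun s hs => (hsub hs).1) fun s hs => ?_
  have e₁ := (chartAt E₁ (γ₁ t)).left_inv (hsub hs).2.1
  have e₂ := (chartAt E₂ (γ₂ t)).left_inv (hsub hs).2.2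
  change chartAt E (f (γ₁ t, γ₂ t)) (f (γ₁ s, γ₂ s)) = chartAt E (f (γ₁ t, γ₂ t))
    (f ((chartAt E₁ (γ₁ t)).symm (chartAt E₁ (γ₁ t) (γ₁ s)),
      (chartAt E₂ (γ₂ t)).symm (chartAt E₂ (γ₂ t) (γ₂ s))))
  rw [e₁, e₂]

theorem ACAt.comp {γ₁ : ℝ → N₁} {f : N₁ → N} {t : ℝ}
    (h₁ : ACAt E₁ γ₁ t) (c₁ : ContinuousAt γ₁ t)
    (hf : ContMDiffAt 𝓘(ℝ, E₁) 𝓘(ℝ, E) 1 f (γ₁ t)) : ACAt E (fun s => f (γ₁ s)) t :=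
  ACAt.comp₂ (f := fun p : N₁ × N₁ => f p.1) h₁ h₁ c₁ c₁
    (ContMDiffAt.comp (γ₁ t, γ₁ t) (g := f) (f := Prod.fst) hf contMDiffAt_fst)

theorem LocAC.comp₂ {γ₁ : ℝ → N₁} {γ₂ : ℝ → N₂} {f : N₁ × N₂ → N}
    (h₁ : LocAC E₁ γ₁) (h₂ : LocAC E₂ γ₂)
    (hf : ∀ t, ContMDiffAt (𝓘(ℝ, E₁).prod 𝓘(ℝ, E₂)) 𝓘(ℝ, E) 1 f (γ₁ t, γ₂ t)) :
    LocAC E (fun s => f (γ₁ s, γ₂ s)) :=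
  ⟨continuous_iff_continuousAt.2 fun t => ContinuousAt.comp (x := t) (g := f)
    (f := fun s => (γ₁ s, γ₂ s)) (hf t).continuousAt
    (h₁.1.continuousAt.prodMk h₂.1.continuousAt),
    fun t => (h₁.2 t).comp₂ (h₂.2 t) h₁.1.continuousAt h₂.1.continuousAt (hf t)⟩

theorem LocAC.comp {γ₁ : ℝ → N₁} {f : N₁ → N} (h₁ : LocAC E₁ γ₁)
    (hf : ∀ t, ContMDiffAt 𝓘(ℝ, E₁) 𝓘(ℝ, E) 1 f (γ₁ t)) : LocAC E (fun s => f (γ₁ s)) :=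
  ⟨continuous_iff_continuousAt.2 fun t => ContinuousAt.comp (x := t) (g := f)
    (hf t).continuousAt h₁.1.continuousAt,
    fun t => (h₁.2 t).comp h₁.1.continuousAt (hf t)⟩

theorem LocAC.comp_monotone {γ : ℝ → N} (h : LocAC E γ) {g : ℝ → ℝ} (hg : Monotone g)
    (hg1 : ∀ x y, dist (g x) (g y) ≤ dist x y) : LocAC E (fun t => γ (g t)) := by
  have hgc : Continuous g := (LipschitzWith.of_dist_le_mul (K := 1) (by simpa using hg1)).continuous
  refine ⟨h.1.comp hgc, fun t => ?_⟩
  obtain ⟨ε, hε, ha⟩ := h.2 (g t)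
  refine ⟨ε, hε, ac_comp_monotone ha hg hg1 fun s hs => ?_⟩
  rw [uIcc_of_le (by linarith), ← Real.closedBall_eq_Icc] at hs ⊢
  exact (hg1 s t).trans hs

theorem locAC_const (p : N) : LocAC E (fun _ : ℝ => p) :=
  ⟨continuous_const, fun _ => ⟨1, one_pos, ac_const _ _ _⟩⟩

theorem locAC_of_vector {u : ℝ → E} (hu : ∀ a b, AbsolutelyContinuousOnInterval u a b) :
    LocAC E u := by
  refine ⟨continuous_iff_continuousAt.2 fun t => ?_, fun t => ⟨1, one_pos, ?_⟩⟩
  · refine (hu (t - 1) (t + 1)).continuousOn.continuousAt ?_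
    rw [uIcc_of_le (by linarith)]
    exact Icc_mem_nhds (by linarith) (by linarith)
  · exact hu _ _

/-- The retraction of `ℝ` onto `[a, b]`. -/
def clamp (a b t : ℝ) : ℝ := max a (min b t)

theorem clamp_monotone (a b : ℝ) : Monotone (clamp a b) := fun _ _ h =>
  max_le_max_left _ (min_le_min_left _ h)

theorem dist_clamp_le (a b x y : ℝ) : dist (clamp a b x) (clamp a b y) ≤ dist x y := by
  unfold clamp
  rw [max_comm a, max_comm a, min_comm b, min_comm b]
  exact (dist_max_le _ _ _).trans (dist_min_le _ _ _)

theorem clamp_mem {a b : ℝ} (h : a ≤ b) (t : ℝ) : clamp a b t ∈ Icc a b :=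
  ⟨le_max_left _ _, max_le h (min_le_left _ _)⟩

theorem clamp_of_mem {a b t : ℝ} (h : t ∈ Icc a b) : clamp a b t = t := by
  simp [clamp, h.1, h.2]

theorem LocAC.clamp {γ : ℝ → N} (h : LocAC E γ) (a b : ℝ) :
    LocAC E (fun t => γ (clamp a b t)) := h.comp_monotone (clamp_monotone a b) (dist_clamp_le a b)

theorem coe_projIcc_eq_clamp (t : ℝ) : (projIcc 0 1 zero_le_one t : ℝ) = HomSRV.clamp 0 1 t := rfl

theorem projIcc_coe' (s : unitInterval) : projIcc (0 : ℝ) 1 zero_le_one (s : ℝ) = s :=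
  projIcc_val zero_le_one s

variable [IsManifold 𝓘(ℝ, E) 1 N]

/-- `IsAC` tests every chart, while `ACAt` uses only the preferred chart at the point. The passage
to another chart is composition with a C¹ map, followed by `ac_of_locally`. -/
theorem LocAC.isAC {γ : unitInterval → N}
    (h : LocAC E (fun t : ℝ => γ (projIcc 0 1 zero_le_one t))) : IsAC E γ := by
  refine ⟨?_, fun x a b hab hsrc => ac_of_locally hab fun t ht => ?_⟩
  · have := h.1.comp (continuous_subtype_val (p := fun t => t ∈ Icc (0:ℝ) 1))
    exact this.congr fun t => congrArg γ (projIcc_coe' t)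
  · have htI : t ∈ Icc (0 : ℝ) 1 := ⟨a.2.1.trans ht.1, ht.2.trans b.2.2⟩
    have hs : γ (projIcc 0 1 zero_le_one t) ∈ (chartAt E x).source := by
      rw [projIcc_of_mem zero_le_one htI]; exact hsrc ⟨t, htI⟩ ⟨ht.1, ht.2⟩
    have := (h.2 t).comp (E := E) (f := chartAt E x) h.1.continuousAt
      (contMDiffAt_of_mem_maximalAtlas (IsManifold.chart_mem_maximalAtlas x) hs)
    exact this

omit [IsManifold 𝓘(ℝ, E) 1 N] in
-- Extending by constants moves all analysis to curves on ℝ, where no endpoint needs separate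
-- treatment. A short interval around t is retracted onto a subinterval of [0,1] mapped into one
-- chart, where `IsAC` applies.
theorem AC.locAC_ext (γ : AC E N) : LocAC E γ.ext := by
  have hc : Continuous γ.ext := γ.2.1.comp continuous_projIcc
  refine ⟨hc, fun t => ?_⟩
  have hn : γ.1 ⁻¹' (chartAt E (γ.ext t)).source ∈ 𝓝 (projIcc 0 1 zero_le_one t) :=
    γ.2.1.continuousAt (chart_source_mem_nhds _ _)
  obtain ⟨ε, hε, hb⟩ := Metric.nhds_basis_closedBall.mem_iff.1 hn
  refine ⟨ε, hε, ?_⟩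
  have hp : ∀ s, dist s t ≤ ε →
      dist (HomSRV.clamp 0 1 s) (HomSRV.clamp 0 1 t) ≤ ε := fun s hs => (dist_clamp_le _ _ _ _).trans hs
  have h1 := hp (t - ε) (by simp [abs_of_pos hε])
  have h2 := hp (t + ε) (by simp [abs_of_pos hε])
  rw [← coe_projIcc_eq_clamp, ← coe_projIcc_eq_clamp, Real.dist_eq, abs_le] at h1 h2
  have hab : projIcc (0 : ℝ) 1 zero_le_one (t - ε) ≤ projIcc 0 1 zero_le_one (t + ε) :=
    monotone_projIcc _ (by linarith)
  have key := γ.2.2 (γ.ext t) _ _ hab fun s hs => hb (by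
    rw [Metric.mem_closedBall, Subtype.dist_eq, Real.dist_eq, abs_le]
    have h3 : (projIcc (0 : ℝ) 1 zero_le_one (t - ε) : ℝ) ≤ s := hs.1
    have h4 : (s : ℝ) ≤ projIcc (0 : ℝ) 1 zero_le_one (t + ε) := hs.2
    constructor <;> linarith)
  refine ac_congr (ac_comp_monotone key (clamp_monotone 0 1) (dist_clamp_le 0 1) fun s hs => ?_)
    fun s _ => ?_
  · rw [uIcc_of_le (by linarith)] at hs
    rw [uIcc_of_le (by exact hab)]
    exact ⟨clamp_monotone _ _ hs.1, clamp_monotone _ _ hs.2⟩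
  · simp only [← coe_projIcc_eq_clamp, projIcc_coe']; rfl

/-- The restriction to `[0,1]` of a locally absolutely continuous curve. -/
def LocAC.toAC {γ : ℝ → N} (h : LocAC E γ) : AC E N :=
  ⟨fun t => γ t, LocAC.isAC (by
    simpa only [coe_projIcc_eq_clamp] using h.clamp 0 1)⟩

theorem LocAC.toAC_apply {γ : ℝ → N} (h : LocAC E γ) (t : unitInterval) : h.toAC t = γ t := rfl

theorem LocAC.toAC_ext {γ : ℝ → N} (h : LocAC E γ) (t : ℝ) :
    h.toAC.ext t = γ (HomSRV.clamp 0 1 t) := rfl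

omit [IsManifold 𝓘(ℝ, E) 1 N] in
theorem AC.ext_coe (γ : AC E N) (t : unitInterval) : γ.ext t = γ t := by
  simp [AC.ext]

end LocallyAC

/-! ### Velocities, and constancy of curves with zero velocity -/

section Velocity

variable {E : Type*} [NormedAddCommGroup E] [NormedSpace ℝ E]
  {N : Type*} [TopologicalSpace N] [ChartedSpace E N]

variable (E) in
/-- The velocity of a curve in a manifold, as an element of the model space. -/
def vel (γ : ℝ → N) (t : ℝ) : E := (mfderiv 𝓘(ℝ, ℝ) 𝓘(ℝ, E) γ t : ℝ →L[ℝ] E) 1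

theorem vel_congr {γ γ' : ℝ → N} {t : ℝ} (h : γ =ᶠ[𝓝 t] γ') : vel E γ t = vel E γ' t := by
  unfold vel
  exact congrArg (fun A : ℝ →L[ℝ] E => A 1) h.mfderiv_eq

theorem vel_const (p : N) (t : ℝ) : vel E (fun _ => p) t = 0 :=
  congrArg (fun A : ℝ →L[ℝ] E => A 1)
    (mfderiv_const (I := 𝓘(ℝ, ℝ)) (I' := 𝓘(ℝ, E)) (x := t) (c := p))

variable {E' : Type*} [NormedAddCommGroup E'] [NormedSpace ℝ E']
  {N' : Type*} [TopologicalSpace N'] [ChartedSpace E' N']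

/-- The differential of a map between manifolds, as a linear map between the model spaces. -/
def tmap (E : Type*) [NormedAddCommGroup E] [NormedSpace ℝ E]
    {N : Type*} [TopologicalSpace N] [ChartedSpace E N]
    (E' : Type*) [NormedAddCommGroup E'] [NormedSpace ℝ E']
    {N' : Type*} [TopologicalSpace N'] [ChartedSpace E' N'] (f : N → N') (p : N) : E →L[ℝ] E' :=
  mfderiv 𝓘(ℝ, E) 𝓘(ℝ, E') f p

theorem vel_comp {γ : ℝ → N} {f : N → N'} {t : ℝ}
    (hf : MDifferentiableAt 𝓘(ℝ, E) 𝓘(ℝ, E') f (γ t)) (hγ : MDifferentiableAt 𝓘(ℝ, ℝ) 𝓘(ℝ, E) γ t) :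
    vel E' (fun s => f (γ s)) t =
      tmap E E' f (γ t) (vel E γ t) :=
  congrArg (fun A : ℝ →L[ℝ] E' => A 1) (mfderiv_comp t hf hγ)

theorem vel_vector (u : ℝ → E) (t : ℝ) : vel E u t = deriv u t := by
  unfold vel
  rw [mfderiv_eq_fderiv]
  rfl

theorem ae_of_locally {p : ℝ → Prop}
    (h : ∀ t, ∃ ε > 0, ∀ᵐ s, s ∈ Ioo (t - ε) (t + ε) → p s) : ∀ᵐ s, p s := by
  rw [ae_iff]
  refine measure_null_of_locally_null _ fun t _ => ?_
  obtain ⟨ε, hε, hs⟩ := h t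
  rw [ae_iff] at hs
  refine ⟨{s | p s}ᶜ ∩ Ioo (t - ε) (t + ε), inter_mem self_mem_nhdsWithin
    (mem_nhdsWithin_of_mem_nhds (Ioo_mem_nhds (by linarith) (by linarith))), ?_⟩
  refine measure_mono_null (fun s hs => ?_) hs
  simp only [mem_ofPred_eq, Classical.not_imp]
  exact ⟨hs.2, hs.1⟩

variable [IsManifold 𝓘(ℝ, E) 1 N]

theorem mdifferentiableAt_of_chart {γ : ℝ → N} {p : N} {t : ℝ} (hc : ContinuousAt γ t)
    (ht : γ t ∈ (chartAt E p).source) (hd : DifferentiableAt ℝ (fun s => chartAt E p (γ s)) t) :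
    MDifferentiableAt 𝓘(ℝ, ℝ) 𝓘(ℝ, E) γ t := by
  have h1 : MDifferentiableAt 𝓘(ℝ, E) 𝓘(ℝ, E) (chartAt E p).symm (chartAt E p (γ t)) :=
    (contMDiffAt_symm_of_mem_maximalAtlas (n := 1) (IsManifold.chart_mem_maximalAtlas p)
      ((chartAt E p).map_source ht)).mdifferentiableAt (by simp)
  have h2 := MDifferentiableAt.comp t (f := fun s => chartAt E p (γ s)) h1 hd.mdifferentiableAt
  refine h2.congr_of_eventuallyEq ?_
  filter_upwards [hc ((chartAt E p).open_source.mem_nhds ht)] with s hs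
  exact ((chartAt E p).left_inv hs).symm

theorem chart_mdifferentiableAt {p q : N} (hq : q ∈ (chartAt E p).source) :
    MDifferentiableAt 𝓘(ℝ, E) 𝓘(ℝ, E) (chartAt E p) q :=
  (contMDiffAt_of_mem_maximalAtlas (n := 1) (IsManifold.chart_mem_maximalAtlas p)
    hq).mdifferentiableAt (by simp)

/-- In a chart the curve has bounded variation in a finite-dimensional space, so it is
differentiable almost everywhere. -/
theorem LocAC.ae_mdifferentiableAt [FiniteDimensional ℝ E] {γ : ℝ → N} (h : LocAC E γ) :
    ∀ᵐ t, MDifferentiableAt 𝓘(ℝ, ℝ) 𝓘(ℝ, E) γ t := by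
  refine ae_of_locally fun t => ?_
  obtain ⟨ε, hε, ha⟩ := h.2 t
  obtain ⟨δ, hδ, hle, hsub⟩ := exists_uIcc_subset hε
    (h.1.continuousAt (chart_source_mem_nhds E (γ t)))
  refine ⟨δ, hδ, ?_⟩
  filter_upwards [ha.boundedVariationOn.ae_differentiableAt_of_mem_uIcc] with s hs hmem
  have hmem' : s ∈ uIcc (t - δ) (t + δ) := Icc_subset_uIcc (Ioo_subset_Icc_self hmem)
  exact mdifferentiableAt_of_chart h.1.continuousAt (hsub hmem') (hs (uIcc_shrink hδ hle hmem'))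

/-- The source of all uniqueness statements. In a chart, an absolutely continuous function with
derivative zero almost everywhere is constant; so the curve is locally constant, and ℝ is connected.
-/
theorem LocAC.eq_of_vel_eq_zero [FiniteDimensional ℝ E] {γ : ℝ → N} (h : LocAC E γ)
    (h0 : ∀ᵐ t, vel E γ t = 0) (s t : ℝ) : γ s = γ t := by
  have hloc : IsLocallyConstant γ := by
    rw [IsLocallyConstant.iff_eventually_eq]
    intro t
    obtain ⟨ε, hε, ha⟩ := h.2 t
    obtain ⟨δ, hδ, hle, hsub⟩ := exists_uIcc_subset hε
      (h.1.continuousAt (chart_source_mem_nhds E (γ t)))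
    have ha' := ha.mono (uIcc_shrink hδ hle)
    have hder : ∀ᵐ s, s ∈ uIcc (t - δ) (t + δ) →
        HasDerivAt (fun s => chartAt E (γ t) (γ s)) 0 s := by
      filter_upwards [h0, h.ae_mdifferentiableAt,
        ha'.boundedVariationOn.ae_differentiableAt_of_mem_uIcc] with s hs1 hs2 hs3 hs
      have h4 := vel_comp (chart_mdifferentiableAt (hsub hs)) hs2
      rw [hs1, map_zero, vel_vector] at h4
      rw [← h4]
      exact (hs3 hs).hasDerivAt
    obtain ⟨C, hC⟩ := ha'.const_of_ae_hasDerivAt_zero hder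
    have hmem : uIcc (t - δ) (t + δ) ∈ 𝓝 t := by
      rw [uIcc_of_le (by linarith)]; exact Icc_mem_nhds (by linarith) (by linarith)
    filter_upwards [hmem] with s hs
    refine (chartAt E (γ t)).injOn (hsub hs) (mem_chart_source _ _) ?_
    rw [hC s hs, hC t (mem_of_mem_nhds hmem)]
  exact hloc.apply_eq_of_isPreconnected isPreconnected_univ (mem_univ _) (mem_univ _)

end Velocity

/-! ### Differentials as maps between model spaces -/

section TangentMap

variable {E : Type*} [NormedAddCommGroup E] [NormedSpace ℝ E]
  {N : Type*} [TopologicalSpace N] [ChartedSpace E N]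
  {E' : Type*} [NormedAddCommGroup E'] [NormedSpace ℝ E']
  {N' : Type*} [TopologicalSpace N'] [ChartedSpace E' N']
  {E'' : Type*} [NormedAddCommGroup E''] [NormedSpace ℝ E'']
  {N'' : Type*} [TopologicalSpace N''] [ChartedSpace E'' N'']

theorem tmap_comp {f : N → N'} {g : N' → N''} {p : N}
    (hg : MDifferentiableAt 𝓘(ℝ, E') 𝓘(ℝ, E'') g (f p))
    (hf : MDifferentiableAt 𝓘(ℝ, E) 𝓘(ℝ, E') f p) :
    tmap E E'' (fun x => g (f x)) p = (tmap E' E'' g (f p)).comp (tmap E E' f p) :=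
  mfderiv_comp p hg hf

theorem tmap_id (p : N) : tmap E E (fun x : N => x) p = ContinuousLinearMap.id ℝ E :=
  mfderiv_id

theorem tmap_congr {f g : N → N'} {p : N} (h : f =ᶠ[𝓝 p] g) :
    tmap E E' f p = tmap E E' g p := h.mfderiv_eq

theorem tmap_of_vector {f : E → N'} {x : E} (hf : MDifferentiableAt 𝓘(ℝ, E) 𝓘(ℝ, E') f x) :
    tmap E E' f x = fderiv ℝ (fun y => chartAt E' (f x) (f y)) x := by
  refine (MDifferentiableAt.mfderiv hf).trans ?_
  simp only [mfld_simps, fderivWithin_univ]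
  rfl

theorem tmap_vector_vector (f : E → E') (x : E) : tmap E E' f x = fderiv ℝ f x := by
  unfold tmap; rw [mfderiv_eq_fderiv]

end TangentMap

/-! ### Left trivialization and logarithmic derivatives in a Lie group -/

section LieGroup

variable {E : Type*} [NormedAddCommGroup E] [NormedSpace ℝ E]
  {G : Type*} [TopologicalSpace G] [ChartedSpace E G] [Group G] [LieGroup 𝓘(ℝ, E) ∞ G]

theorem mdifferentiableAt_mul_left (g h : G) :
    MDifferentiableAt 𝓘(ℝ, E) 𝓘(ℝ, E) (fun x : G => g * x) h :=
  (contMDiff_mul_left (I := 𝓘(ℝ, E)) (n := ∞)).mdifferentiable (by simp) h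

theorem mdifferentiableAt_mul_right (g h : G) :
    MDifferentiableAt 𝓘(ℝ, E) 𝓘(ℝ, E) (fun x : G => x * g) h :=
  (contMDiff_mul_right (I := 𝓘(ℝ, E)) (n := ∞)).mdifferentiable (by simp) h

theorem mdifferentiableAt_conj (y h : G) :
    MDifferentiableAt 𝓘(ℝ, E) 𝓘(ℝ, E) (fun x : G => y * x * y⁻¹) h :=
  (mdifferentiableAt_mul_right y⁻¹ (y * h)).comp h (mdifferentiableAt_mul_left y h)

/-- `toLieAlgebra g`, as an endomorphism of the model space. -/
def leftTriv (E : Type*) [NormedAddCommGroup E] [NormedSpace ℝ E]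
    {G : Type*} [TopologicalSpace G] [ChartedSpace E G] [Group G] (g : G) : E →L[ℝ] E :=
  tmap E E (fun x : G => g⁻¹ * x) g

/-- The adjoint action, as an endomorphism of the model space. -/
def adj (E : Type*) [NormedAddCommGroup E] [NormedSpace ℝ E]
    {G : Type*} [TopologicalSpace G] [ChartedSpace E G] [Group G] (y : G) : E →L[ℝ] E :=
  tmap E E (fun x : G => y * x * y⁻¹) 1

theorem tmap_mul_left_leftTriv (g : G) (v : E) :
    tmap E E (fun x : G => g * x) 1 (leftTriv E g v) = v := by
  have h := tmap_comp (f := fun x : G => g⁻¹ * x) (g := fun x : G => g * x) (p := g)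
    (mdifferentiableAt_mul_left (E := E) g _) (mdifferentiableAt_mul_left (E := E) g⁻¹ g)
  simp only [mul_inv_cancel_left, tmap_id, inv_mul_cancel] at h
  exact (congrArg (fun A : E →L[ℝ] E => A v) h).symm

theorem leftTriv_tmap_mul_left (g : G) (v : E) :
    leftTriv E g (tmap E E (fun x : G => g * x) 1 v) = v := by
  have h := tmap_comp (f := fun x : G => g * x) (g := fun x : G => g⁻¹ * x) (p := 1)
    (mdifferentiableAt_mul_left (E := E) g⁻¹ _) (mdifferentiableAt_mul_left (E := E) g 1)
  simp only [inv_mul_cancel_left, tmap_id, mul_one] at h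
  exact (congrArg (fun A : E →L[ℝ] E => A v) h).symm

theorem adj_one : adj E (1 : G) = ContinuousLinearMap.id ℝ E := by
  have : (fun x : G => 1 * x * 1⁻¹) = fun x => x := by ext; simp
  unfold adj
  rw [this, tmap_id]

theorem adj_mul (y z : G) : adj E (y * z) = (adj E y).comp (adj E z) := by
  have h := tmap_comp (f := fun x : G => z * x * z⁻¹) (g := fun x : G => y * x * y⁻¹) (p := 1)
    (mdifferentiableAt_conj (E := E) y _) (mdifferentiableAt_conj (E := E) z 1)
  have h2 : (fun x : G => y * (z * x * z⁻¹) * y⁻¹) = fun x => (y * z) * x * (y * z)⁻¹ := by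
    ext; group
  have h3 : z * 1 * z⁻¹ = 1 := by simp
  rw [h2, h3] at h
  exact h

theorem adj_inv_adj (y : G) (v : E) : adj E y⁻¹ (adj E y v) = v := by
  have := adj_mul (E := E) y⁻¹ y
  rw [inv_mul_cancel, adj_one] at this
  exact (congrArg (fun A : E →L[ℝ] E => A v) this).symm

theorem vel_mul_of_eq_one {c d : ℝ → G} {t : ℝ} (hc : MDifferentiableAt 𝓘(ℝ, ℝ) 𝓘(ℝ, E) c t)
    (hd : MDifferentiableAt 𝓘(ℝ, ℝ) 𝓘(ℝ, E) d t) (hc0 : c t = 1) (hd0 : d t = 1) :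
    vel E (fun s => c s * d s) t = vel E c t + vel E d t := by
  have h3 := hc.hasMFDerivAt.prodMk hd.hasMFDerivAt
  have h4 : MDifferentiableAt (𝓘(ℝ, E).prod 𝓘(ℝ, E)) 𝓘(ℝ, E)
      (fun p : G × G => p.1 * p.2) (c t, d t) :=
    ((contMDiff_mul 𝓘(ℝ, E) ∞).mdifferentiable (by simp)) _
  have h5 := (h4.hasMFDerivAt.comp t h3).mfderiv
  have h6 : ∀ p : G × G, p = (1, 1) → ∀ u : E × E,
      (mfderiv (𝓘(ℝ, E).prod 𝓘(ℝ, E)) 𝓘(ℝ, E) (fun p : G × G => p.1 * p.2) p : E × E →L[ℝ] E) u =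
        u.1 + u.2 := by
    rintro p rfl u; exact mfderiv_mul_one u
  exact (congrArg (fun A : ℝ →L[ℝ] E => A 1) h5).trans (h6 (c t, d t) (by rw [hc0, hd0]) _)

variable (E) in
/-- The left logarithmic derivative `γ(t)⁻¹ γ'(t)` of a curve in `G`. -/
def logDeriv (γ : ℝ → G) (t : ℝ) : E := leftTriv E (γ t) (vel E γ t)

theorem logDeriv_eq_vel {γ : ℝ → G} {t : ℝ} (h : MDifferentiableAt 𝓘(ℝ, ℝ) 𝓘(ℝ, E) γ t) :
    logDeriv E γ t = vel E (fun s => (γ t)⁻¹ * γ s) t :=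
  (vel_comp (f := fun x => (γ t)⁻¹ * x) (mdifferentiableAt_mul_left _ _) h).symm

theorem logDeriv_congr {γ γ' : ℝ → G} {t : ℝ} (h : γ =ᶠ[𝓝 t] γ') :
    logDeriv E γ t = logDeriv E γ' t := by
  unfold logDeriv; rw [vel_congr h, h.eq_of_nhds]

theorem logDeriv_const (g : G) (t : ℝ) : logDeriv E (fun _ => g) t = 0 := by
  unfold logDeriv; rw [vel_const, map_zero]

theorem logDeriv_eq_zero_iff {γ : ℝ → G} {t : ℝ} : logDeriv E γ t = 0 ↔ vel E γ t = 0 := by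
  refine ⟨fun h => ?_, fun h => by rw [logDeriv, h, map_zero]⟩
  have := tmap_mul_left_leftTriv (γ t) (vel E γ t)
  rw [show leftTriv E (γ t) (vel E γ t) = 0 from h, map_zero] at this
  exact this.symm

theorem mdifferentiableAt_group_mul {a b : ℝ → G} {t : ℝ}
    (ha : MDifferentiableAt 𝓘(ℝ, ℝ) 𝓘(ℝ, E) a t) (hb : MDifferentiableAt 𝓘(ℝ, ℝ) 𝓘(ℝ, E) b t) :
    MDifferentiableAt 𝓘(ℝ, ℝ) 𝓘(ℝ, E) (fun s => a s * b s) t :=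
  MDifferentiableAt.comp t (g := fun p : G × G => p.1 * p.2) (f := fun s => (a s, b s))
    (((contMDiff_mul 𝓘(ℝ, E) ∞).mdifferentiable (by simp)) _) (ha.prodMk hb)

theorem mdifferentiableAt_group_inv {a : ℝ → G} {t : ℝ}
    (ha : MDifferentiableAt 𝓘(ℝ, ℝ) 𝓘(ℝ, E) a t) :
    MDifferentiableAt 𝓘(ℝ, ℝ) 𝓘(ℝ, E) (fun s => (a s)⁻¹) t :=
  MDifferentiableAt.comp t (g := fun p : G => p⁻¹) (f := a)
    (((contMDiff_inv 𝓘(ℝ, E) ∞).mdifferentiable (by simp)) _) ha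

/-- With t fixed, (a(t)b(t))⁻¹a(s)b(s) is the product of b(t)⁻¹(a(t)⁻¹a(s))b(t) and b(t)⁻¹b(s). Both
factors pass through 1 at s = t, where velocities of a product add. -/
theorem logDeriv_mul {a b : ℝ → G} {t : ℝ}
    (ha : MDifferentiableAt 𝓘(ℝ, ℝ) 𝓘(ℝ, E) a t) (hb : MDifferentiableAt 𝓘(ℝ, ℝ) 𝓘(ℝ, E) b t) :
    logDeriv E (fun s => a s * b s) t =
      adj E (b t)⁻¹ (logDeriv E a t) + logDeriv E b t := by
  rw [logDeriv_eq_vel (mdifferentiableAt_group_mul ha hb), logDeriv_eq_vel ha, logDeriv_eq_vel hb]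
  have ha' : MDifferentiableAt 𝓘(ℝ, ℝ) 𝓘(ℝ, E) (fun s => (a t)⁻¹ * a s) t :=
    (mdifferentiableAt_mul_left (E := E) (a t)⁻¹ (a t)).comp t ha
  have hb' : MDifferentiableAt 𝓘(ℝ, ℝ) 𝓘(ℝ, E) (fun s => (b t)⁻¹ * b s) t :=
    (mdifferentiableAt_mul_left (E := E) (b t)⁻¹ (b t)).comp t hb
  have hc := mdifferentiableAt_conj (E := E) (b t)⁻¹ ((a t)⁻¹ * a t)
  have e1 := vel_comp (f := fun x => (b t)⁻¹ * x * (b t)⁻¹⁻¹) hc ha'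
  simp only [inv_mul_cancel] at e1
  unfold adj
  have e2 := vel_mul_of_eq_one (hc.comp t ha') hb' (by simp) (by simp)
  simp only [Function.comp_def] at e2
  rw [← e1, ← e2]
  congr 1
  ext s
  group

/-- The product rule applied to the constant curve a·a⁻¹ = 1. -/
theorem logDeriv_inv {a : ℝ → G} {t : ℝ} (ha : MDifferentiableAt 𝓘(ℝ, ℝ) 𝓘(ℝ, E) a t) :
    logDeriv E (fun s => (a s)⁻¹) t = - adj E (a t) (logDeriv E a t) := by
  have h := logDeriv_mul ha (mdifferentiableAt_group_inv ha)
  simp only [mul_inv_cancel, logDeriv_const, inv_inv] at h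
  exact (neg_eq_of_add_eq_zero_right h.symm).symm

theorem logDeriv_const_mul (g : G) {a : ℝ → G} {t : ℝ}
    (ha : MDifferentiableAt 𝓘(ℝ, ℝ) 𝓘(ℝ, E) a t) :
    logDeriv E (fun s => g * a s) t = logDeriv E a t := by
  have h := logDeriv_mul (a := fun _ => g) mdifferentiableAt_const ha
  rw [logDeriv_const, map_zero, zero_add] at h
  exact h

theorem logDeriv_mul_const (g : G) {a : ℝ → G} {t : ℝ}
    (ha : MDifferentiableAt 𝓘(ℝ, ℝ) 𝓘(ℝ, E) a t) :
    logDeriv E (fun s => a s * g) t = adj E g⁻¹ (logDeriv E a t) := by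
  have h := logDeriv_mul (b := fun _ => g) ha mdifferentiableAt_const
  rw [logDeriv_const, add_zero] at h
  exact h

theorem LocAC.mul {a b : ℝ → G} (ha : LocAC E a) (hb : LocAC E b) :
    LocAC E (fun s => a s * b s) :=
  LocAC.comp₂ (f := fun p : G × G => p.1 * p.2) ha hb fun _ =>
    ((contMDiff_mul 𝓘(ℝ, E) ∞).of_le (by simp)).contMDiffAt

theorem LocAC.inv {a : ℝ → G} (ha : LocAC E a) : LocAC E (fun s => (a s)⁻¹) :=
  LocAC.comp (f := fun p : G => p⁻¹) ha fun _ =>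
    ((contMDiff_inv 𝓘(ℝ, E) ∞).of_le (by simp)).contMDiffAt

/-! ### The group operations in the chart at the identity -/

theorem contMDiffAt_chart_symm_one {x : E} (hx : x ∈ (chartAt E (1 : G)).target) :
    ContMDiffAt 𝓘(ℝ, E) 𝓘(ℝ, E) ∞ (chartAt E (1 : G)).symm x :=
  contMDiffAt_symm_of_mem_maximalAtlas (IsManifold.chart_mem_maximalAtlas _) hx

theorem contMDiffAt_chart_one {g : G} (hg : g ∈ (chartAt E (1 : G)).source) :
    ContMDiffAt 𝓘(ℝ, E) 𝓘(ℝ, E) ∞ (chartAt E (1 : G)) g :=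
  contMDiffAt_of_mem_maximalAtlas (IsManifold.chart_mem_maximalAtlas _) hg

theorem contDiffAt_chart_inv_mul {x y : E} (hx : x ∈ (chartAt E (1 : G)).target)
    (hy : y ∈ (chartAt E (1 : G)).target)
    (hxy : ((chartAt E (1 : G)).symm x)⁻¹ * (chartAt E (1 : G)).symm y ∈
      (chartAt E (1 : G)).source) :
    ContDiffAt ℝ ∞ (fun p : E × E => chartAt E (1 : G)
      (((chartAt E (1 : G)).symm p.1)⁻¹ * (chartAt E (1 : G)).symm p.2)) (x, y) := by
  rw [← contMDiffAt_iff_contDiffAt]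
  have h1 : ContMDiffAt 𝓘(ℝ, E × E) 𝓘(ℝ, E) ∞
      (fun p : E × E => (chartAt E (1 : G)).symm p.1) (x, y) :=
    ContMDiffAt.comp (x, y) (contMDiffAt_chart_symm_one hx) contDiff_fst.contMDiff.contMDiffAt
  have h2 : ContMDiffAt 𝓘(ℝ, E × E) 𝓘(ℝ, E) ∞
      (fun p : E × E => (chartAt E (1 : G)).symm p.2) (x, y) :=
    ContMDiffAt.comp (x, y) (contMDiffAt_chart_symm_one hy) contDiff_snd.contMDiff.contMDiffAt
  exact ContMDiffAt.comp (x, y) (contMDiffAt_chart_one hxy) (h1.inv.mul h2)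

theorem contDiffAt_chart_mul {x y : E} (hx : x ∈ (chartAt E (1 : G)).target)
    (hy : y ∈ (chartAt E (1 : G)).target)
    (hxy : (chartAt E (1 : G)).symm x * (chartAt E (1 : G)).symm y ∈
      (chartAt E (1 : G)).source) :
    ContDiffAt ℝ ∞ (fun p : E × E => chartAt E (1 : G)
      ((chartAt E (1 : G)).symm p.1 * (chartAt E (1 : G)).symm p.2)) (x, y) := by
  rw [← contMDiffAt_iff_contDiffAt]
  have h1 : ContMDiffAt 𝓘(ℝ, E × E) 𝓘(ℝ, E) ∞
      (fun p : E × E => (chartAt E (1 : G)).symm p.1) (x, y) :=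
    ContMDiffAt.comp (x, y) (contMDiffAt_chart_symm_one hx) contDiff_fst.contMDiff.contMDiffAt
  have h2 : ContMDiffAt 𝓘(ℝ, E × E) 𝓘(ℝ, E) ∞
      (fun p : E × E => (chartAt E (1 : G)).symm p.2) (x, y) :=
    ContMDiffAt.comp (x, y) (contMDiffAt_chart_symm_one hy) contDiff_snd.contMDiff.contMDiffAt
  exact ContMDiffAt.comp (x, y) (contMDiffAt_chart_one hxy) (h1.mul h2)

/-- The left trivialization of the tangent bundle, read in the chart at the identity. -/
def chartTriv (E : Type*) [NormedAddCommGroup E] [NormedSpace ℝ E]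
    (G : Type*) [TopologicalSpace G] [ChartedSpace E G] [Group G] (x : E) : E →L[ℝ] E :=
  (leftTriv E ((chartAt E (1 : G)).symm x)).comp (tmap E E (chartAt E (1 : G)).symm x)

theorem chartTriv_eq {x : E} (hx : x ∈ (chartAt E (1 : G)).target) :
    chartTriv E G x = tmap E E
      (fun y => ((chartAt E (1 : G)).symm x)⁻¹ * (chartAt E (1 : G)).symm y) x :=
  (tmap_comp (g := fun z : G => ((chartAt E (1 : G)).symm x)⁻¹ * z)
    (mdifferentiableAt_mul_left _ _)
    ((contMDiffAt_chart_symm_one hx).mdifferentiableAt (by simp))).symm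

/-- The trivialization at x is the partial derivative in the second variable, on the diagonal, of
the smooth map (x, y) ↦ x⁻¹y read in the chart; there its value is 1, so a single chart suffices. -/
theorem continuousOn_chartTriv :
    ContinuousOn (chartTriv E G) (chartAt E (1 : G)).target := by
  set φ := chartAt E (1 : G) with hφ
  have hF : ∀ x ∈ φ.target, ContDiffAt ℝ ∞
      (fun p : E × E => φ ((φ.symm p.1)⁻¹ * φ.symm p.2)) (x, x) := fun x hx =>
    contDiffAt_chart_inv_mul hx hx (by rw [inv_mul_cancel]; exact mem_chart_source E (1 : G))
  have key : ∀ x ∈ φ.target, chartTriv E G x =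
      (fderiv ℝ (fun p : E × E => φ ((φ.symm p.1)⁻¹ * φ.symm p.2)) (x, x)).comp
        (ContinuousLinearMap.inr ℝ E E) := fun x hx => by
    have hm : MDifferentiableAt 𝓘(ℝ, E) 𝓘(ℝ, E) (fun y => (φ.symm x)⁻¹ * φ.symm y) x :=
      (mdifferentiableAt_mul_left (E := E) (φ.symm x)⁻¹ (φ.symm x)).comp x
        ((contMDiffAt_chart_symm_one hx).mdifferentiableAt (by simp))
    rw [chartTriv_eq hx, tmap_of_vector hm, inv_mul_cancel]
    exact (HasFDerivAt.comp x (((hF x hx).differentiableAt (by simp)).hasFDerivAt)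
      (hasFDerivAt_prodMk_right x x)).fderiv
  refine ContinuousOn.congr (fun x hx => ContinuousAt.continuousWithinAt ?_) key
  refine ContinuousAt.clm_comp ?_ continuousAt_const
  exact ContinuousAt.comp (f := fun x : E => (x, x))
    ((hF x hx).fderiv_right (m := 0) (by simp)).continuousAt
    (continuousAt_id.prodMk continuousAt_id)

variable [FiniteDimensional ℝ E]

theorem LocAC.logDeriv_mul {a b : ℝ → G} (ha : LocAC E a) (hb : LocAC E b) :
    ∀ᵐ t, logDeriv E (fun s => a s * b s) t = adj E (b t)⁻¹ (logDeriv E a t) + logDeriv E b t := by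
  filter_upwards [ha.ae_mdifferentiableAt, hb.ae_mdifferentiableAt] with t h1 h2
  exact HomSRV.logDeriv_mul h1 h2

theorem LocAC.logDeriv_inv {a : ℝ → G} (ha : LocAC E a) :
    ∀ᵐ t, logDeriv E (fun s => (a s)⁻¹) t = - adj E (a t) (logDeriv E a t) := by
  filter_upwards [ha.ae_mdifferentiableAt] with t h1
  exact HomSRV.logDeriv_inv h1

theorem LocAC.eq_of_logDeriv_eq_zero {γ : ℝ → G} (h : LocAC E γ)
    (h0 : ∀ᵐ t, logDeriv E γ t = 0) (s t : ℝ) : γ s = γ t :=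
  h.eq_of_vel_eq_zero (h0.mono fun _ => logDeriv_eq_zero_iff.1) s t

/-- A curve is determined by its logarithmic derivative and one value. -/
theorem LocAC.eq_of_logDeriv_eq {a b : ℝ → G} (ha : LocAC E a) (hb : LocAC E b)
    (h : ∀ᵐ t, logDeriv E a t = logDeriv E b t) {t₀ : ℝ} (h0 : a t₀ = b t₀) : a = b := by
  -- The product and inverse rules give Ad(b)(a⁻¹a' - b⁻¹b').
  have hz : ∀ᵐ t, logDeriv E (fun s => a s * (b s)⁻¹) t = 0 := by
    filter_upwards [ha.logDeriv_mul hb.inv, hb.logDeriv_inv, h] with t h1 h2 h3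
    rw [h1, h2, h3, inv_inv, add_neg_cancel]
  ext t
  have := (ha.mul hb.inv).eq_of_logDeriv_eq_zero hz t t₀
  rwa [h0, mul_inv_cancel, mul_inv_eq_one] at this

/-- In the chart at 1 the logarithmic derivative is `chartTriv` along the curve applied to the chart
derivative: a continuous, hence locally bounded, factor times an integrable one. -/
theorem LocAC.locallyIntegrable_logDeriv {γ : ℝ → G} (h : LocAC E γ) :
    LocallyIntegrable (logDeriv E γ) volume := by
  intro t₀
  set φ := chartAt E (1 : G) with hφ
  -- Left translation brings the curve into the chart at 1 near t₀ and leaves the logarithmic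
  -- derivative unchanged.
  set c : ℝ → G := fun s => (γ t₀)⁻¹ * γ s with hc
  have hcAC : LocAC E c := (locAC_const (γ t₀)⁻¹).mul h
  have hc0 : c t₀ = 1 := by simp [hc]
  set u : ℝ → E := fun s => φ (c s) with hu
  obtain ⟨ε, hε, ha⟩ := hcAC.2 t₀
  rw [hc0] at ha
  obtain ⟨δ, hδ, hle, hsub⟩ := exists_uIcc_subset hε
    (hcAC.1.continuousAt.preimage_mem_nhds (t := φ.source)
      (by rw [hc0]; exact chart_source_mem_nhds E (1 : G)))
  have ha' := ha.mono (uIcc_shrink hδ hle)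
  have hI : uIcc (t₀ - δ) (t₀ + δ) = Icc (t₀ - δ) (t₀ + δ) := uIcc_of_le (by linarith)
  have hucont : ContinuousOn (fun s => chartTriv E G (u s)) (Icc (t₀ - δ) (t₀ + δ)) := by
    rw [← hI]
    exact continuousOn_chartTriv.comp ha'.continuousOn fun s hs => φ.map_source (hsub hs)
  have hint : IntegrableOn (deriv u) (Icc (t₀ - δ) (t₀ + δ)) volume := by
    have := ac_intervalIntegrable_deriv ha'
    rwa [intervalIntegrable_iff_integrableOn_Icc_of_le (by linarith)] at this
  obtain ⟨C, hC⟩ := isCompact_Icc.exists_bound_of_continuousOn hucont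
  have hprod : IntegrableOn (fun s => chartTriv E G (u s) (deriv u s))
      (Icc (t₀ - δ) (t₀ + δ)) volume := by
    refine Integrable.mono' (hint.norm.const_mul C) ?_ ?_
    · exact ((ContinuousLinearMap.id ℝ (E →L[ℝ] E)).aestronglyMeasurable_comp₂
        (hucont.aestronglyMeasurable measurableSet_Icc) hint.aestronglyMeasurable)
    · filter_upwards [ae_restrict_mem measurableSet_Icc] with s hs
      exact ((chartTriv E G (u s)).le_opNorm _).trans
        (mul_le_mul_of_nonneg_right (hC s hs) (norm_nonneg _))
  refine ⟨Icc (t₀ - δ) (t₀ + δ), Icc_mem_nhds (by linarith) (by linarith), ?_⟩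
  refine hprod.congr ?_
  rw [Filter.EventuallyEq, ae_restrict_iff' measurableSet_Icc]
  filter_upwards [h.ae_mdifferentiableAt, hcAC.ae_mdifferentiableAt,
    ha'.boundedVariationOn.ae_differentiableAt_of_mem_uIcc] with s h1 h2 h3 hs
  rw [← hI] at hs
  have hd : DifferentiableAt ℝ u s := h3 hs
  have hx : u s ∈ φ.target := φ.map_source (hsub hs)
  have e1 : φ.symm (u s) = c s := φ.left_inv (hsub hs)
  rw [← logDeriv_const_mul (γ t₀)⁻¹ h1, chartTriv, ContinuousLinearMap.comp_apply, ← hφ, e1,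
    ← vel_vector u s, ← vel_comp (f := φ.symm)
    ((contMDiffAt_chart_symm_one hx).mdifferentiableAt (by simp)) hd.mdifferentiableAt]
  unfold logDeriv
  congr 1
  refine vel_congr ?_
  filter_upwards [hcAC.1.continuousAt (φ.open_source.mem_nhds (hsub hs))] with r hr
  exact φ.left_inv hr

end LieGroup

/-! ### Local sections and fibre curves of submersions -/

section Submersion

variable {E : Type*} [NormedAddCommGroup E] [NormedSpace ℝ E]
  {N : Type*} [TopologicalSpace N] [ChartedSpace E N] [IsManifold 𝓘(ℝ, E) ∞ N]
  {F : Type*} [NormedAddCommGroup F] [NormedSpace ℝ F]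
  {M : Type*} [TopologicalSpace M] [ChartedSpace F M] [IsManifold 𝓘(ℝ, F) ∞ M]

/-- A submersion has smooth local sections. -/
theorem exists_local_section {f : N → M} {p : N} (h : IsSubmersionAt 𝓘(ℝ, E) 𝓘(ℝ, F) ∞ f p) :
    ∃ σ : M → N, ∀ᶠ x in 𝓝 (f p), f (σ x) = x ∧ ContMDiffAt 𝓘(ℝ, F) 𝓘(ℝ, E) ∞ σ x := by
  set φ := h.domChart with hφ
  set ψ := h.codChart with hψ
  set e := h.equiv with he
  have hw : ∀ x ∈ φ.target, ψ (f (φ.symm x)) = (e x).1 := fun x hx => by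
    have hx' : x ∈ (h.domChart.extend 𝓘(ℝ, E)).target := by simpa using hx
    simpa using h.writtenInCharts hx'
  have hp : p ∈ φ.source := h.mem_domChart_source
  have hfp : f p ∈ ψ.source := h.mem_codChart_source
  have hsrc : φ.source ⊆ f ⁻¹' ψ.source := h.source_subset_preimage_source
  have h0 : (e (φ p)).1 = ψ (f p) := by
    rw [← hw _ (φ.map_source hp), φ.left_inv hp]
  -- In adapted charts `f` is a linear projection; the section freezes the complementary coordinate
  -- at its value at `p`.
  set j : F → E := fun y => e.symm (y, (e (φ p)).2) with hj
  have hj0 : j (ψ (f p)) = φ p := by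
    rw [hj]; simp only; rw [← h0]; exact e.symm_apply_apply _
  have hjc : ContDiff ℝ ∞ j := e.symm.contDiff.comp (contDiff_id.prodMk contDiff_const)
  have hjψ : ContinuousAt (fun x => j (ψ x)) (f p) :=
    ContinuousAt.comp (g := j) hjc.continuous.continuousAt (ψ.continuousAt hfp)
  refine ⟨fun x => φ.symm (j (ψ x)), ?_⟩
  have hev : ∀ᶠ x in 𝓝 (f p), j (ψ x) ∈ φ.target := hjψ.eventually_mem
    (φ.open_target.mem_nhds (by rw [hj0]; exact φ.map_source hp))
  filter_upwards [hev, ψ.open_source.mem_nhds hfp] with x hx hxs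
  refine ⟨ψ.injOn (hsrc (φ.map_target hx)) hxs ?_, ?_⟩
  · rw [hw _ hx, hj]; simp
  · refine ContMDiffAt.comp x (g := φ.symm) (f := fun x => j (ψ x))
      (contMDiffAt_symm_of_mem_maximalAtlas h.domChart_mem_maximalAtlas hx) ?_
    exact ContMDiffAt.comp x (g := j) hjc.contMDiff.contMDiffAt
      (contMDiffAt_of_mem_maximalAtlas h.codChart_mem_maximalAtlas hxs)

/-- A vector in the kernel of the differential of a submersion is the velocity of a smooth curve in
the fibre. -/
theorem exists_curve_in_fiber {f : N → M} {p : N} (h : IsSubmersionAt 𝓘(ℝ, E) 𝓘(ℝ, F) ∞ f p)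
    {v : E} (hv : tmap E F f p v = 0) :
    ∃ c : ℝ → N, ContMDiff 𝓘(ℝ, ℝ) 𝓘(ℝ, E) ∞ c ∧ c 0 = p ∧ (∀ t, f (c t) = f p) ∧
      vel E c 0 = v := by
  set φ := h.domChart with hφ
  set ψ := h.codChart with hψ
  set e := h.equiv with he
  have hw : ∀ x ∈ φ.target, ψ (f (φ.symm x)) = (e x).1 := fun x hx => by
    have hx' : x ∈ (h.domChart.extend 𝓘(ℝ, E)).target := by simpa using hx
    simpa using h.writtenInCharts hx'
  have hp : p ∈ φ.source := h.mem_domChart_source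
  have hfp : f p ∈ ψ.source := h.mem_codChart_source
  have hsrc : φ.source ⊆ f ⁻¹' ψ.source := h.source_subset_preimage_source
  have ht : φ p ∈ φ.target := φ.map_source hp
  have hφd : MDifferentiableAt 𝓘(ℝ, E) 𝓘(ℝ, E) φ p :=
    (contMDiffAt_of_mem_maximalAtlas h.domChart_mem_maximalAtlas hp).mdifferentiableAt (by simp)
  have hφs : ∀ x ∈ φ.target, ContMDiffAt 𝓘(ℝ, E) 𝓘(ℝ, E) ∞ φ.symm x := fun x hx =>
    contMDiffAt_symm_of_mem_maximalAtlas h.domChart_mem_maximalAtlas hx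
  have hφsd : MDifferentiableAt 𝓘(ℝ, E) 𝓘(ℝ, E) φ.symm (φ p) :=
    (hφs _ ht).mdifferentiableAt (by simp)
  have hψd : MDifferentiableAt 𝓘(ℝ, F) 𝓘(ℝ, F) ψ (f p) :=
    (contMDiffAt_of_mem_maximalAtlas h.codChart_mem_maximalAtlas hfp).mdifferentiableAt (by simp)
  have hfd : MDifferentiableAt 𝓘(ℝ, E) 𝓘(ℝ, F) f p := h.contMDiffAt.mdifferentiableAt (by simp)
  set w : E := tmap E E φ p v with hwdef
  have hvw : tmap E E φ.symm (φ p) w = v := by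
    have h1 := tmap_comp hφsd hφd
    rw [tmap_congr (g := fun x => x) (by
      filter_upwards [φ.open_source.mem_nhds hp] with x hx using φ.left_inv hx), tmap_id] at h1
    exact (congrArg (fun A : E →L[ℝ] E => A v) h1).symm
  -- In the adapted charts the differential of `f` is the first projection, so `w` has only a
  -- complementary component and moving along it stays in the fibre.
  have hew : (e w).1 = 0 := by
    have h1 : tmap E F (fun x => ψ (f (φ.symm x))) (φ p) =
        (ContinuousLinearMap.fst ℝ F _).comp (e : E →L[ℝ] F × h.complement) := by
      rw [tmap_congr (g := fun x => (e x).1) (by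
        filter_upwards [φ.open_target.mem_nhds ht] with x hx using hw x hx), tmap_vector_vector]
      exact ((ContinuousLinearMap.fst ℝ F _).comp (e : E →L[ℝ] F × h.complement)).fderiv
    have hfd' : MDifferentiableAt 𝓘(ℝ, E) 𝓘(ℝ, F) f (φ.symm (φ p)) := by rwa [φ.left_inv hp]
    have hψd' : MDifferentiableAt 𝓘(ℝ, F) 𝓘(ℝ, F) ψ (f (φ.symm (φ p))) := by rwa [φ.left_inv hp]
    have h2 := tmap_comp (f := fun x => f (φ.symm x)) hψd' (hfd'.comp _ hφsd)
    have h3 := tmap_comp hfd' hφsd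
    have h4 := congrArg (fun A : E →L[ℝ] F => A w) (h1.symm.trans h2)
    simp only [h3, ContinuousLinearMap.comp_apply, hvw, φ.left_inv hp, hv, map_zero] at h4
    exact h4
  obtain ⟨r, hr, hball⟩ := Metric.isOpen_iff.1 φ.open_target _ ht
  -- The curve must be defined on all of ℝ. The function δ sin(t/δ) has derivative 1 at 0 and is
  -- bounded by δ, and δ‖w‖ < r keeps the curve in the chart.
  set δ : ℝ := r / (‖w‖ + 1) with hδ
  have hδ0 : 0 < δ := by positivity
  set g : ℝ → E := fun t => φ p + (δ * Real.sin (t / δ)) • w with hg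
  have hgt : ∀ t, g t ∈ φ.target := fun t => hball (by
    rw [Metric.mem_ball, dist_eq_norm, hg]
    simp only [add_sub_cancel_left, norm_smul, Real.norm_eq_abs, abs_mul, abs_of_pos hδ0]
    have hs := Real.abs_sin_le_one (t / δ)
    calc δ * |Real.sin (t / δ)| * ‖w‖ ≤ δ * 1 * ‖w‖ := by gcongr
      _ < δ * (‖w‖ + 1) := by nlinarith
      _ = r := by rw [hδ]; field_simp)
  have hgc : ContDiff ℝ ∞ g := contDiff_const.add
    ((contDiff_const.mul (Real.contDiff_sin.comp (contDiff_id.div_const δ))).smul contDiff_const)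
  have hg0 : g 0 = φ p := by simp [hg]
  have hgd : HasDerivAt g w 0 := by
    have h1 : HasDerivAt (fun t : ℝ => t / δ) (1 / δ) 0 := (hasDerivAt_id 0).div_const δ
    have h2 := ((h1.sin.const_mul δ).smul_const w).const_add (φ p)
    refine h2.congr_deriv ?_
    simp [hδ0.ne']
  refine ⟨fun t => φ.symm (g t), fun t => ?_, by simp only [hg0, φ.left_inv hp], fun t => ?_, ?_⟩
  · exact ContMDiffAt.comp t (g := φ.symm) (hφs _ (hgt t)) hgc.contMDiff.contMDiffAt
  · refine ψ.injOn (hsrc (φ.map_target (hgt t))) hfp ?_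
    have h0 := hw _ ht
    rw [φ.left_inv hp] at h0
    rw [hw _ (hgt t), h0, hg]
    simp [hew]
  · have h1 := vel_comp (γ := g) (t := 0) (f := φ.symm) (by rw [hg0]; exact hφsd)
      hgd.differentiableAt.mdifferentiableAt
    rw [h1, vel_vector, hgd.deriv, hg0, hvw]

end Submersion

/-! ### Vertical vectors of G → G/K and the Lie algebra of K -/

section Quotient

variable {E : Type*} [NormedAddCommGroup E] [NormedSpace ℝ E]
  {G : Type*} [TopologicalSpace G] [ChartedSpace E G] [Group G] [LieGroup 𝓘(ℝ, E) ∞ G]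
  {K : Subgroup G} {F : Type*} [NormedAddCommGroup F] [NormedSpace ℝ F]
  [ChartedSpace F (G ⧸ K)] [IsManifold 𝓘(ℝ, F) ∞ (G ⧸ K)]

/-- The Lie algebra of `K`, as a subspace of the model space. -/
def lieAlgModel (E : Type*) [NormedAddCommGroup E] [NormedSpace ℝ E]
    {G : Type*} [TopologicalSpace G] [ChartedSpace E G] [Group G] [LieGroup 𝓘(ℝ, E) ∞ G]
    (K : Subgroup G) : Submodule ℝ E := lieAlg (E := E) K

theorem mem_lieAlgModel {v : E} : v ∈ lieAlgModel E K ↔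
    ∃ c : ℝ → G, ContMDiff 𝓘(ℝ, ℝ) 𝓘(ℝ, E) ∞ c ∧ (∀ t, c t ∈ K) ∧ c 0 = 1 ∧ vel E c 0 = v :=
  Iff.rfl

/-- A vertical vector is the velocity of a curve in the fibre pK, and translating by p⁻¹ puts this
curve in K. Conversely, for a curve c in K the curve pc projects to a point. -/
theorem tmap_mk_eq_zero_iff
    (hπ : IsSubmersion 𝓘(ℝ, E) 𝓘(ℝ, F) ∞ (QuotientGroup.mk : G → G ⧸ K)) (p : G) (v : E) :
    tmap E F (QuotientGroup.mk : G → G ⧸ K) p v = 0 ↔ leftTriv E p v ∈ lieAlgModel E K := by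
  rw [mem_lieAlgModel]
  have hd : ∀ g : G, MDifferentiableAt 𝓘(ℝ, E) 𝓘(ℝ, F) (QuotientGroup.mk : G → G ⧸ K) g :=
    fun g => hπ.contMDiff.mdifferentiable (by simp) g
  constructor
  · intro hv
    obtain ⟨c, hc, hc0, hcf, hcv⟩ := exists_curve_in_fiber (hπ.isSubmersionAt p) hv
    refine ⟨fun t => p⁻¹ * c t, contMDiff_const.mul hc, fun t => ?_, by simp [hc0], ?_⟩
    · exact QuotientGroup.eq.1 (hcf t).symm
    · have := vel_comp (t := 0) (γ := c) (f := fun x => p⁻¹ * x)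
        (mdifferentiableAt_mul_left (E := E) p⁻¹ (c 0)) (hc.mdifferentiable (by simp) 0)
      rw [this, hc0, hcv]
      rfl
  · rintro ⟨c, hc, hcK, hc0, hcv⟩
    have hpc : ContMDiff 𝓘(ℝ, ℝ) 𝓘(ℝ, E) ∞ (fun t => p * c t) := contMDiff_const.mul hc
    have h1 := vel_comp (t := 0) (γ := c) (f := fun x => p * x)
        (mdifferentiableAt_mul_left (E := E) p (c 0)) (hc.mdifferentiable (by simp) 0)
    rw [hc0, hcv, tmap_mul_left_leftTriv] at h1
    have h2 := vel_comp (t := 0) (γ := fun t => p * c t) (hd _) (hpc.mdifferentiable (by simp) 0)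
    rw [h1, hc0, mul_one] at h2
    rw [← h2]
    have : (fun s => ((p * c s : G) : G ⧸ K)) = fun _ => (p : G ⧸ K) := by
      ext s
      exact (QuotientGroup.eq.2 (by simpa using hcK s)).symm
    rw [this, vel_const]

theorem adj_mem_lieAlgModel {y : G} (hy : y ∈ K) {v : E} (hv : v ∈ lieAlgModel E K) :
    adj E y v ∈ lieAlgModel E K := by
  obtain ⟨c, hc, hcK, hc0, hcv⟩ := mem_lieAlgModel.1 hv
  refine mem_lieAlgModel.2 ⟨fun t => y * c t * y⁻¹, (contMDiff_const.mul hc).mul contMDiff_const,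
    fun t => K.mul_mem (K.mul_mem hy (hcK t)) (K.inv_mem hy), by simp [hc0], ?_⟩
  rw [vel_comp (f := fun x => y * x * y⁻¹) (mdifferentiableAt_conj y (c 0))
    (hc.mdifferentiable (by simp) 0), hc0, hcv]
  rfl

variable [FiniteDimensional ℝ E] [FiniteDimensional ℝ F]

theorem LocAC.mk (hπ : IsSubmersion 𝓘(ℝ, E) 𝓘(ℝ, F) ∞ (QuotientGroup.mk : G → G ⧸ K))
    {γ : ℝ → G} (h : LocAC E γ) : LocAC F (fun t => (γ t : G ⧸ K)) :=
  h.comp fun _ => (hπ.contMDiff.of_le (by simp)).contMDiffAt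

/-- A curve whose logarithmic derivative is in the Lie algebra of `K` stays in a coset of `K`. -/
theorem LocAC.mk_eq_of_logDeriv_mem
    (hπ : IsSubmersion 𝓘(ℝ, E) 𝓘(ℝ, F) ∞ (QuotientGroup.mk : G → G ⧸ K))
    {γ : ℝ → G} (h : LocAC E γ) (h0 : ∀ᵐ t, logDeriv E γ t ∈ lieAlgModel E K) (s t : ℝ) :
    (γ s : G ⧸ K) = γ t := by
  -- The velocity is vertical almost everywhere, so the projected curve has zero velocity.
  refine (h.mk hπ).eq_of_vel_eq_zero ?_ s t
  filter_upwards [h0, h.ae_mdifferentiableAt] with t h1 h2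
  rw [vel_comp (hπ.contMDiff.mdifferentiable (by simp) _) h2]
  exact (tmap_mk_eq_zero_iff hπ _ _).2 h1

/-- The logarithmic derivative of a curve in `K` is in the Lie algebra of `K`. -/
theorem LocAC.logDeriv_mem_of_mem
    (hπ : IsSubmersion 𝓘(ℝ, E) 𝓘(ℝ, F) ∞ (QuotientGroup.mk : G → G ⧸ K))
    {γ : ℝ → G} (h : LocAC E γ) (h0 : ∀ t, γ t ∈ K) :
    ∀ᵐ t, logDeriv E γ t ∈ lieAlgModel E K := by
  filter_upwards [h.ae_mdifferentiableAt] with t h2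
  refine (tmap_mk_eq_zero_iff hπ _ _).1 ?_
  rw [← vel_comp (hπ.contMDiff.mdifferentiable (by simp) _) h2]
  have : (fun s => (γ s : G ⧸ K)) = fun _ => ((1 : G) : G ⧸ K) := by
    ext s
    exact QuotientGroup.eq.2 (by simpa using h0 s)
  rw [this, vel_const]

end Quotient

/-! ### Contraction argument for an integrable control -/

section Picard

variable {E : Type*} [NormedAddCommGroup E] [NormedSpace ℝ E]

theorem integrable_clm_apply {A : ℝ → E →L[ℝ] E} {w : ℝ → E} {B : ℝ} (hA : Continuous A)
    (hB : ∀ t, ‖A t‖ ≤ B) (hw : Integrable w) : Integrable (fun t => A t (w t)) := by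
  refine Integrable.mono' (hw.norm.const_mul B) ?_ (.of_forall fun t => ?_)
  · exact (ContinuousLinearMap.id ℝ (E →L[ℝ] E)).aestronglyMeasurable_comp₂
      hA.aestronglyMeasurable hw.aestronglyMeasurable
  · exact ((A t).le_opNorm _).trans (mul_le_mul_of_nonneg_right (hB t) (norm_nonneg _))

theorem norm_intervalIntegral_le {f : ℝ → E} {g : ℝ → ℝ} (hg : Integrable g)
    (h : ∀ s, ‖f s‖ ≤ g s) (a b : ℝ) : ‖∫ s in a..b, f s‖ ≤ ∫ s, g s := by
  have hg0 : ∀ s, 0 ≤ g s := fun s => (norm_nonneg _).trans (h s)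
  calc ‖∫ s in a..b, f s‖ ≤ ∫ s in uIoc a b, g s := by
        refine intervalIntegral.norm_intervalIntegral_eq f a b volume ▸ ?_
        exact norm_integral_le_of_norm_le hg.integrableOn (.of_forall h)
    _ ≤ ∫ s, g s := setIntegral_le_integral hg (.of_forall hg0)

variable [CompleteSpace E]

/-- The Picard–Lindelöf theorem for a linear control system `u' = C(u) w` with small integrable
control `w`. -/
theorem exists_solution_of_small {C : E → E →L[ℝ] E} {K : NNReal} (hC : LipschitzWith K C)
    (x₀ : E) {w : ℝ → E} (hw : Integrable w) (hK : K * ∫ s, ‖w s‖ ≤ 1 / 2) :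
    ∃ u : ℝ → E, Continuous u ∧ (∃ B, ∀ t, ‖C (u t)‖ ≤ B) ∧
      (∀ t, u t = x₀ + ∫ s in (0 : ℝ)..t, C (u s) (w s)) ∧
      ∀ t, ‖u t - x₀‖ ≤ 2 * (‖C x₀‖ * ∫ s, ‖w s‖) := by
  set I := ∫ s, ‖w s‖ with hI
  have hI0 : 0 ≤ I := integral_nonneg fun _ => norm_nonneg _
  have hCle : ∀ x y, ‖C x - C y‖ ≤ K * ‖x - y‖ := fun x y => by
    simpa [dist_eq_norm] using hC.dist_le_mul x y
  have hCb : ∀ u : BoundedContinuousFunction ℝ E, ∀ t, ‖C (u t)‖ ≤ ‖C 0‖ + K * ‖u‖ := fun u t => by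
    have h1 := hCle (u t) 0
    have h2 := norm_le_insert' (C (u t)) (C 0)
    rw [sub_zero] at h1
    have h3 : (K : ℝ) * ‖u t‖ ≤ K * ‖u‖ := by gcongr; exact u.norm_coe_le_norm t
    linarith
  have hint : ∀ u : BoundedContinuousFunction ℝ E, Integrable (fun s => C (u s) (w s)) := fun u =>
    integrable_clm_apply (hC.continuous.comp u.continuous) (hCb u) hw
  -- The Picard operator on bounded continuous functions on the whole line. Smallness of K∫‖w‖, not
  -- of the time interval, makes it a 1/2-contraction.
  let T : BoundedContinuousFunction ℝ E → BoundedContinuousFunction ℝ E := fun u =>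
    BoundedContinuousFunction.ofNormedAddCommGroup
      (fun t => x₀ + ∫ s in (0 : ℝ)..t, C (u s) (w s))
      (continuous_const.add (intervalIntegral.continuous_primitive
        (fun a b => (hint u).intervalIntegrable) 0))
      (‖x₀‖ + ∫ s, ‖C (u s) (w s)‖) fun t => (norm_add_le _ _).trans
        (add_le_add le_rfl (norm_intervalIntegral_le (hint u).norm (fun _ => le_rfl) 0 t))
  have hT : ∀ u t, T u t = x₀ + ∫ s in (0 : ℝ)..t, C (u s) (w s) := fun u t => rfl
  have hlip : ∀ u v, dist (T u) (T v) ≤ (1 / 2 : NNReal) * dist u v := fun u v => by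
    rw [BoundedContinuousFunction.dist_le (by positivity)]
    intro t
    rw [dist_eq_norm, hT, hT, add_sub_add_left_eq_sub, ← intervalIntegral.integral_sub
      (hint u).intervalIntegrable (hint v).intervalIntegrable]
    have hg : Integrable (fun s => K * dist u v * ‖w s‖) := hw.norm.const_mul _
    refine (norm_intervalIntegral_le hg (fun s => ?_) 0 t).trans ?_
    · rw [← sub_apply]
      refine ((C (u s) - C (v s)).le_opNorm _).trans ?_
      gcongr
      refine (hCle _ _).trans ?_
      gcongr
      rw [← dist_eq_norm]
      exact BoundedContinuousFunction.dist_coe_le_dist s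
    · rw [integral_const_mul, ← hI]
      push_cast
      nlinarith [mul_le_mul_of_nonneg_right hK (dist_nonneg (x := u) (y := v))]
  have hcon : ContractingWith (1 / 2) T := ⟨by rw [← NNReal.coe_lt_coe]; push_cast; norm_num,
    LipschitzWith.of_dist_le_mul hlip⟩
  set u := hcon.fixedPoint with hu
  have hfix : T u = u := hcon.fixedPoint_isFixedPt
  refine ⟨u, u.continuous, ⟨_, hCb u⟩, fun t => by rw [← hT, hfix], fun t => ?_⟩
  let k : BoundedContinuousFunction ℝ E := BoundedContinuousFunction.const ℝ x₀
  -- For the fixed point u, d(u, k) ≤ d(Tu, Tk) + d(Tk, k) ≤ d(u, k)/2 + ‖C x₀‖ I.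
  have h1 : dist u k ≤ 2 * (‖C x₀‖ * I) := by
    have h2 : dist (T k) k ≤ ‖C x₀‖ * I := by
      rw [BoundedContinuousFunction.dist_le (by positivity)]
      intro t
      rw [dist_eq_norm, hT]
      simp only [k, BoundedContinuousFunction.const_apply, add_sub_cancel_left]
      refine (norm_intervalIntegral_le (hw.norm.const_mul ‖C x₀‖)
        (fun s => (C x₀).le_opNorm _) 0 t).trans ?_
      rw [integral_const_mul]
    have h3 := hlip u k
    rw [hfix] at h3
    push_cast at h3
    have h4 := dist_triangle u (T k) k
    linarith
  rw [← dist_eq_norm]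
  exact (BoundedContinuousFunction.dist_coe_le_dist (g := k) t).trans h1

end Picard

/-! ### Curves with prescribed logarithmic derivative -/

section LieODE

variable {E : Type*} [NormedAddCommGroup E] [NormedSpace ℝ E] [FiniteDimensional ℝ E]
  {G : Type*} [TopologicalSpace G] [ChartedSpace E G] [Group G] [LieGroup 𝓘(ℝ, E) ∞ G]

/-- Left translates of tangent vectors at the identity, read in the chart at the identity. -/
def chartLeft (E : Type*) [NormedAddCommGroup E] [NormedSpace ℝ E]
    (G : Type*) [TopologicalSpace G] [ChartedSpace E G] [Group G] (x : E) : E →L[ℝ] E :=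
  (fderiv ℝ (fun p : E × E => chartAt E (1 : G)
      ((chartAt E (1 : G)).symm p.1 * (chartAt E (1 : G)).symm p.2))
    (x, chartAt E (1 : G) 1)).comp (ContinuousLinearMap.inr ℝ E E)

theorem chart_symm_one : (chartAt E (1 : G)).symm (chartAt E (1 : G) 1) = 1 :=
  (chartAt E (1 : G)).left_inv (mem_chart_source E (1 : G))

theorem contDiffAt_chart_mul_one {x : E} (hx : x ∈ (chartAt E (1 : G)).target) :
    ContDiffAt ℝ ∞ (fun p : E × E => chartAt E (1 : G)
      ((chartAt E (1 : G)).symm p.1 * (chartAt E (1 : G)).symm p.2))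
      (x, chartAt E (1 : G) 1) :=
  contDiffAt_chart_mul hx (mem_chart_target E (1 : G)) (by
    rw [chart_symm_one, mul_one]; exact (chartAt E (1 : G)).map_target hx)

theorem chartLeft_eq {x : E} (hx : x ∈ (chartAt E (1 : G)).target) :
    HasFDerivAt (fun y => chartAt E (1 : G)
      ((chartAt E (1 : G)).symm x * (chartAt E (1 : G)).symm y)) (chartLeft E G x)
      (chartAt E (1 : G) 1) :=
  HasFDerivAt.comp (chartAt E (1 : G) 1)
    (((contDiffAt_chart_mul_one hx).differentiableAt (by simp)).hasFDerivAt)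
    (hasFDerivAt_prodMk_right x (chartAt E (1 : G) 1))

/-- A partial derivative of the smooth multiplication is C¹ at the point of the chart representing
1, hence Lipschitz nearby. -/
theorem exists_lipschitzOnWith_chartLeft :
    ∃ (K : NNReal), ∃ V ∈ 𝓝 (chartAt E (1 : G) 1), LipschitzOnWith K (chartLeft E G) V := by
  have h := (contDiffAt_chart_mul_one (mem_chart_target E (1 : G))).fderiv_right (m := 1)
    (by norm_cast)
  refine ContDiffAt.exists_lipschitzOnWith (ContDiffAt.clm_comp ?_ contDiffAt_const)
  exact ContDiffAt.comp (g := fderiv ℝ (fun p : E × E => chartAt E (1 : G)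
      ((chartAt E (1 : G)).symm p.1 * (chartAt E (1 : G)).symm p.2)))
      (f := fun x => (x, chartAt E (1 : G) 1))
    (chartAt E (1 : G) 1) h (contDiffAt_id.prodMk contDiffAt_const)

/-- The chain rule for L_g⁻¹ ∘ L_g = id at the identity, where g is the point with coordinate x. -/
theorem chartTriv_chartLeft {x : E} (hx : x ∈ (chartAt E (1 : G)).target) (v : E) :
    chartTriv E G x (chartLeft E G x v) = v := by
  set φ := chartAt E (1 : G) with hφ
  have h1 := chartLeft_eq (G := G) hx
  have hx1 : φ (φ.symm x * φ.symm (φ 1)) = x := by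
    rw [chart_symm_one, mul_one, φ.right_inv hx]
  have hm : MDifferentiableAt 𝓘(ℝ, E) 𝓘(ℝ, E) (fun y => (φ.symm x)⁻¹ * φ.symm y)
      (φ (φ.symm x * φ.symm (φ 1))) := by
    rw [hx1]
    exact (mdifferentiableAt_mul_left (E := E) (φ.symm x)⁻¹ (φ.symm x)).comp x
      ((contMDiffAt_chart_symm_one hx).mdifferentiableAt (by simp))
  have h2 := tmap_comp (f := fun y => φ (φ.symm x * φ.symm y)) hm h1.differentiableAt.mdifferentiableAt
  rw [hx1, ← chartTriv_eq hx, tmap_vector_vector, h1.fderiv] at h2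
  have hsm : MDifferentiableAt 𝓘(ℝ, E) 𝓘(ℝ, E) φ.symm (φ 1) :=
    (contMDiffAt_chart_symm_one (mem_chart_target E (1 : G))).mdifferentiableAt (by simp)
  have hcont : ContinuousAt (fun y => φ.symm x * φ.symm y) (φ 1) :=
    ((mdifferentiableAt_mul_left (E := E) (φ.symm x) _).comp _ hsm).continuousAt
  have h3 : tmap E E (fun y => (φ.symm x)⁻¹ * φ.symm (φ (φ.symm x * φ.symm y))) (φ 1) =
      ContinuousLinearMap.id ℝ E := by
    rw [tmap_congr (g := φ.symm), tmap_of_vector hsm, chart_symm_one]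
    · refine HasFDerivAt.fderiv ((hasFDerivAt_id (φ 1)).congr_of_eventuallyEq ?_)
      filter_upwards [φ.open_target.mem_nhds (mem_chart_target E (1 : G))] with y hy
      exact φ.right_inv hy
    · have hs : φ.symm x * φ.symm (φ 1) ∈ φ.source := by
        rw [chart_symm_one, mul_one]; exact φ.map_target hx
      filter_upwards [hcont (φ.open_source.mem_nhds hs)] with y hy
      have := φ.left_inv hy
      rw [this, inv_mul_cancel_left]
  rw [h3] at h2
  exact (congrArg (fun A : E →L[ℝ] E => A v) h2).symm

/-- Curves in `G` with a given small integrable logarithmic derivative. -/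
theorem exists_locAC_of_small : ∃ δ > 0, ∀ w : ℝ → E, Integrable w → ∫ s, ‖w s‖ < δ →
    ∃ m : ℝ → G, LocAC E m ∧ (∀ᵐ t, logDeriv E m t = w t) ∧
      ∀ c ≥ 0, (∀ s ≤ c, w s = 0) → ∀ t ≤ c, m t = 1 := by
  set φ := chartAt E (1 : G) with hφ
  obtain ⟨K, V, hV, hK⟩ := exists_lipschitzOnWith_chartLeft (E := E) (G := G)
  -- The contraction argument needs a globally Lipschitz coefficient; the solution will not leave
  -- `V`, where the extension agrees with `chartLeft`.
  obtain ⟨C, hC, hCV⟩ := hK.extend_finite_dimension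
  set K' := lipschitzExtensionConstant (E →L[ℝ] E) * K with hK'
  obtain ⟨r, hr, hball⟩ := Metric.mem_nhds_iff.1
    (inter_mem hV (φ.open_target.mem_nhds (mem_chart_target E (1 : G))))
  -- The first bound makes the Picard operator contract; the second keeps the solution in the ball
  -- of radius `r` around the coordinate of 1.
  refine ⟨min (1 / (2 * (K' + 1))) (r / (2 * (‖C (φ 1)‖ + 1))), by positivity,
    fun w hw hsmall => ?_⟩
  have hI0 : 0 ≤ ∫ s, ‖w s‖ := integral_nonneg fun _ => norm_nonneg _
  have hs1 : (K' : ℝ) * ∫ s, ‖w s‖ ≤ 1 / 2 := by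
    have h := (hsmall.trans_le (min_le_left _ _)).le
    rw [le_div_iff₀ (by positivity)] at h
    nlinarith
  have hs2 : 2 * (‖C (φ 1)‖ * ∫ s, ‖w s‖) < r := by
    have h := hsmall.trans_le (min_le_right _ _)
    rw [lt_div_iff₀ (by positivity)] at h
    nlinarith
  obtain ⟨u, huc, ⟨B, hB⟩, hu, hub⟩ := exists_solution_of_small hC (φ 1) hw hs1
  have hmem : ∀ t, u t ∈ V ∩ φ.target := fun t => hball (by
    rw [Metric.mem_ball, dist_eq_norm]; exact (hub t).trans_lt hs2)
  have hint : Integrable (fun s => C (u s) (w s)) :=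
    integrable_clm_apply (hC.continuous.comp huc) hB hw
  have huAC : LocAC E u := by
    refine locAC_of_vector fun a b => ?_
    exact ac_congr ((ac_const (φ 1) a b).add (ac_integral (c := 0)
      fun _ _ => hint.intervalIntegrable)) fun t _ => hu t
  have hm : LocAC E (fun t => φ.symm (u t)) := huAC.comp fun t =>
    (contMDiffAt_chart_symm_one (hmem t).2).of_le (by simp)
  refine ⟨fun t => φ.symm (u t), hm, ?_, fun c hc h0 t ht => ?_⟩
  -- Lebesgue differentiation turns the integral equation into u' = C(u)w almost everywhere.
  · filter_upwards [LocallyIntegrable.ae_hasDerivAt_integral hint.locallyIntegrable] with t ht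
    have hd : HasDerivAt u (C (u t) (w t)) t :=
      ((ht 0).const_add (φ 1)).congr_of_eventuallyEq (.of_forall hu)
    rw [← hCV (hmem t).1] at hd
    have h1 := vel_comp (f := φ.symm)
      ((contMDiffAt_chart_symm_one (hmem t).2).mdifferentiableAt (by simp))
      hd.differentiableAt.mdifferentiableAt
    rw [vel_vector, hd.deriv] at h1
    rw [logDeriv, h1]
    exact chartTriv_chartLeft (hmem t).2 (w t)
  · have : ∫ s in (0 : ℝ)..t, C (u s) (w s) = 0 := by
      refine intervalIntegral.integral_zero_ae (.of_forall fun s hs => ?_)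
      have : s ≤ c := by
        rw [mem_uIoc] at hs
        rcases hs with hs | hs <;> linarith [hs.2]
      rw [h0 s this, map_zero]
    simp only [hu t, this, add_zero]
    exact chart_symm_one

/-- Existence of curves in `G` with given integrable logarithmic derivative. -/
theorem exists_locAC_of_logDeriv {w : ℝ → E} (hw : Integrable w) (a : G) :
    ∃ m : ℝ → G, LocAC E m ∧ m 0 = a ∧ ∀ᵐ t, logDeriv E m t = (Ioc 0 1).indicator w t := by
  obtain ⟨δ, hδ, hsol⟩ := exists_locAC_of_small (E := E) (G := G)
  have hcont : Continuous (fun t => ∫ s in (0 : ℝ)..t, ‖w s‖) :=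
    intervalIntegral.continuous_primitive (fun _ _ => hw.norm.intervalIntegrable) 0
  -- Uniform continuity of t ↦ ∫‖w‖ on [0,1] cuts it into `n + 1` equal pieces, each carrying less
  -- than `δ` of the integral.
  obtain ⟨η, hη, hunif⟩ := Metric.uniformContinuousOn_iff.1
    (isCompact_Icc.uniformContinuousOn_of_continuous (s := Icc (0 : ℝ) 1) hcont.continuousOn) δ hδ
  obtain ⟨n, hn⟩ := exists_nat_one_div_lt hη
  set N : ℝ := n + 1 with hN
  have hN0 : 0 < N := by positivity
  have key : ∀ k : ℕ, k ≤ n + 1 → ∃ m : ℝ → G, LocAC E m ∧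
      ∀ᵐ t, logDeriv E m t = (Ioc 0 (k / N)).indicator w t := by
    intro k
    induction k with
    | zero =>
      intro _
      exact ⟨fun _ => 1, locAC_const 1, .of_forall fun t => by simp [logDeriv_const]⟩
    | succ k ih =>
      intro hk
      obtain ⟨m, hm, hm'⟩ := ih (by omega)
      have hkN : ((k + 1 : ℕ) : ℝ) ≤ N := by rw [hN]; exact_mod_cast hk
      have hle : (k : ℝ) / N ≤ (k + 1 : ℕ) / N := by gcongr; simp
      have h0 : 0 ≤ (k : ℝ) / N := by positivity
      have h1 : ((k + 1 : ℕ) : ℝ) / N ≤ 1 := by rw [div_le_one hN0]; exact hkN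
      set S := Ioc ((k : ℝ) / N) ((k + 1 : ℕ) / N) with hS
      have hsmall : ∫ s, ‖S.indicator w s‖ < δ := by
        have h2 := hunif _ ⟨h0.trans hle, h1⟩ _ ⟨h0, hle.trans h1⟩ (by
          rw [Real.dist_eq, ← sub_div, Nat.cast_succ, add_sub_cancel_left, abs_of_pos (by positivity)]
          exact hn)
        rw [Real.dist_eq, intervalIntegral.integral_interval_sub_left
          hw.norm.intervalIntegrable hw.norm.intervalIntegrable,
          intervalIntegral.integral_of_le hle] at h2
        simp only [norm_indicator_eq_indicator_norm]
        rw [integral_indicator measurableSet_Ioc]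
        exact (le_abs_self _).trans_lt h2
      obtain ⟨m', hmAC, hlog, hone⟩ := hsol (S.indicator w)
        (hw.indicator measurableSet_Ioc) hsmall
      refine ⟨fun t => m t * m' t, hm.mul hmAC, ?_⟩
      filter_upwards [hm.logDeriv_mul hmAC, hm', hlog] with t e1 e2 e3
      rw [e1, e2, e3]
      -- The new factor is 1 up to time k/N, so Ad leaves the old derivative unchanged there; after
      -- k/N the old derivative is zero. Thus the two controls simply add.
      have hone' := hone _ h0 (fun s hs => indicator_of_notMem (fun h => absurd h.1 hs.not_gt) w)
      by_cases ht : t ≤ k / N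
      · rw [hone' t ht, inv_one, adj_one, ContinuousLinearMap.id_apply,
          indicator_of_notMem (s := S) (fun h => absurd h.1 ht.not_gt), add_zero]
        simp only [indicator, mem_Ioc, ht, ht.trans hle]
      · rw [indicator_of_notMem (fun h => ht h.2), map_zero, zero_add]
        push Not at ht
        simp only [indicator, hS, mem_Ioc, ht, h0.trans_lt ht]
  obtain ⟨m, hm, hm'⟩ := key (n + 1) le_rfl
  rw [show ((n + 1 : ℕ) : ℝ) / N = 1 by rw [hN]; push_cast; exact div_self (by positivity)] at hm'
  refine ⟨fun t => (a * (m 0)⁻¹) * m t, (locAC_const _).mul hm, by simp, ?_⟩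
  filter_upwards [hm', hm.ae_mdifferentiableAt] with t h1 h2
  rw [logDeriv_const_mul _ h2, h1]

end LieODE

/-! ### Comparing curves on [0,1] with their extensions to ℝ -/

section Ext

variable {E : Type*} [NormedAddCommGroup E] [NormedSpace ℝ E]
  {N : Type*} [TopologicalSpace N] [ChartedSpace E N]

theorem projIcc_eventuallyEq {t : ℝ} (ht : t ∉ Icc (0 : ℝ) 1) :
    (fun s : ℝ => projIcc (0 : ℝ) 1 zero_le_one s) =ᶠ[𝓝 t]
      fun _ => projIcc 0 1 zero_le_one t := by
  rw [mem_Icc, not_and_or, not_le, not_le] at ht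
  rcases ht with ht | ht
  · filter_upwards [Iio_mem_nhds ht] with s hs
    rw [projIcc_of_le_left _ (le_of_lt hs), projIcc_of_le_left _ ht.le]
  · filter_upwards [Ioi_mem_nhds ht] with s hs
    rw [projIcc_of_right_le _ (le_of_lt hs), projIcc_of_right_le _ ht.le]

theorem AC.vel_ext_eq_zero (γ : AC E N) {t : ℝ} (ht : t ∉ Icc (0 : ℝ) 1) : vel E γ.ext t = 0 := by
  rw [← vel_const (E := E) (γ.ext t) t]
  refine vel_congr ?_
  filter_upwards [projIcc_eventuallyEq ht] with s hs
  exact congrArg γ.1 hs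

theorem LocAC.toAC_ext_eventuallyEq [IsManifold 𝓘(ℝ, E) 1 N] {γ : ℝ → N} (h : LocAC E γ) {t : ℝ}
    (ht : t ∈ Ioo (0 : ℝ) 1) : h.toAC.ext =ᶠ[𝓝 t] γ := by
  filter_upwards [Ioo_mem_nhds ht.1 ht.2] with s hs
  rw [h.toAC_ext, clamp_of_mem (Ioo_subset_Icc_self hs)]

theorem ae_lebI_iff {p : ℝ → Prop} : (∀ᵐ t ∂lebI, p t) ↔ ∀ᵐ t, t ∈ Icc (0 : ℝ) 1 → p t :=
  ae_restrict_iff' measurableSet_Icc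

/-- The endpoints are discarded because a clamped curve agrees with the original near t only for
interior t. -/
theorem ae_lebI_of_Ioo {p : ℝ → Prop} (h : ∀ᵐ t, t ∈ Ioo (0 : ℝ) 1 → p t) :
    ∀ᵐ t ∂lebI, p t := by
  rw [ae_lebI_iff]
  have h0 : ∀ᵐ t : ℝ, t ≠ 0 := by simp [ae_iff, measure_singleton]
  have h1 : ∀ᵐ t : ℝ, t ≠ 1 := by simp [ae_iff, measure_singleton]
  filter_upwards [h, h0, h1] with t h2 h3 h4 h5
  exact h2 ⟨lt_of_le_of_ne h5.1 h3.symm, lt_of_le_of_ne h5.2 h4⟩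

theorem AC.eq_of_ext_eq {γ γ' : AC E N} (h : γ.ext = γ'.ext) : γ = γ' := by
  refine Subtype.ext (funext fun t => ?_)
  have := congrFun h t
  rwa [γ.ext_coe, γ'.ext_coe] at this

end Ext

/-! ### Existence and uniqueness of horizontal lifts -/

section Lifts

variable {E : Type*} [NormedAddCommGroup E] [NormedSpace ℝ E] [FiniteDimensional ℝ E]
  {G : Type*} [TopologicalSpace G] [ChartedSpace E G] [Group G] [LieGroup 𝓘(ℝ, E) ∞ G]
  {K : Subgroup G} {F : Type*} [NormedAddCommGroup F] [NormedSpace ℝ F] [FiniteDimensional ℝ F]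
  [ChartedSpace F (G ⧸ K)] [IsManifold 𝓘(ℝ, F) ∞ (G ⧸ K)]

theorem AC.logDeriv_ext_eq_zero (γ : AC E G) {t : ℝ} (ht : t ∉ Icc (0 : ℝ) 1) :
    logDeriv E γ.ext t = 0 := by rw [logDeriv, γ.vel_ext_eq_zero ht, map_zero]

/-- Curves in `G ⧸ K` lift to curves in `G`. -/
theorem exists_lift (hπ : IsSubmersion 𝓘(ℝ, E) 𝓘(ℝ, F) ∞ (QuotientGroup.mk : G → G ⧸ K))
    {β : ℝ → G ⧸ K} (hβ : LocAC F β) {a₀ : G} (h0 : (a₀ : G ⧸ K) = β 0) :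
    ∃ a : ℝ → G, LocAC E a ∧ a 0 = a₀ ∧ ∀ t ∈ Icc (0 : ℝ) 1, (a t : G ⧸ K) = β t := by
  have hsec : ∀ s : unitInterval, ∃ (σ : G ⧸ K → G) (V : Set (G ⧸ K)), IsOpen V ∧ β s ∈ V ∧
      ∀ x ∈ V, (σ x : G ⧸ K) = x ∧ ContMDiffAt 𝓘(ℝ, F) 𝓘(ℝ, E) ∞ σ x := fun s => by
    obtain ⟨p, hp⟩ := QuotientGroup.mk_surjective (β s)
    obtain ⟨σ, hσ⟩ := exists_local_section (hπ.isSubmersionAt p)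
    rw [hp] at hσ
    obtain ⟨V, hV, hVo, hmem⟩ := eventually_nhds_iff.1 hσ
    exact ⟨σ, V, hVo, hmem, hV⟩
  choose σ V hVo hVmem hV using hsec
  obtain ⟨τ, hτ0, hτm, ⟨n, hn⟩, hτ⟩ := exists_monotone_Icc_subset_open_cover_unitInterval
    (c := fun s => {t : unitInterval | β t ∈ V s})
    (fun s => (hVo s).preimage (hβ.1.comp continuous_subtype_val))
    (fun s _ => mem_iUnion.2 ⟨s, hVmem s⟩)
  have key : ∀ n, ∃ a : ℝ → G, LocAC E a ∧ a 0 = a₀ ∧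
      ∀ t ∈ Icc (0 : ℝ) (τ n), (a t : G ⧸ K) = β t := by
    intro n
    induction n with
    | zero =>
      refine ⟨fun _ => a₀, locAC_const a₀, rfl, fun t ht => ?_⟩
      rw [hτ0] at ht
      rw [show t = 0 from le_antisymm ht.2 ht.1]
      exact h0
    | succ n ih =>
      obtain ⟨a, ha, ha0, hat⟩ := ih
      obtain ⟨i, hi⟩ := hτ n
      set s : ℝ := (τ n : ℝ) with hs
      set s' : ℝ := (τ (n + 1) : ℝ) with hs'
      have hs0 : 0 ≤ s := (τ n).2.1
      have hss' : s ≤ s' := hτm (Nat.le_succ n)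
      have hs1 : s' ≤ 1 := (τ (n + 1)).2.2
      have hVi : ∀ r ∈ Icc s s', β r ∈ V i := fun r hr =>
        hi (show (⟨r, hs0.trans hr.1, hr.2.trans hs1⟩ : unitInterval) ∈ _ from ⟨hr.1, hr.2⟩)
      -- Clamping keeps β inside the domain of one local section and makes `b` constant before `s`.
      set b : ℝ → G := fun r => σ i (β (clamp s s' r)) with hb
      have hbAC : LocAC E b := (hβ.clamp s s').comp fun r =>
        (hV i _ (hVi _ (clamp_mem hss' r))).2.of_le (by simp)
      have hbr : ∀ r ∈ Icc s s', (b r : G ⧸ K) = β r := fun r hr => by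
        rw [hb]; simp only
        rw [(hV i _ (hVi _ (clamp_mem hss' r))).1, clamp_of_mem hr]
      have hble : ∀ r ≤ s, b r = b s := fun r hr => by
        simp [hb, clamp, hr, hr.trans hss', hss']
      -- Before s this is a(r). After s it is b(r)·(b(s)⁻¹a(s)), whose last factor is in K because
      -- a(s) and b(s) both project to β(s).
      refine ⟨fun r => b r * (b s)⁻¹ * a (clamp 0 s r),
        (hbAC.mul (locAC_const _)).mul (ha.clamp 0 s), ?_, fun r hr => ?_⟩
      · beta_reduce
        rw [hble 0 hs0, mul_inv_cancel, one_mul, clamp_of_mem ⟨le_rfl, hs0⟩, ha0]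
      · beta_reduce
        rcases le_total r s with h | h
        · rw [hble r h, mul_inv_cancel, one_mul, clamp_of_mem ⟨hr.1, h⟩, hat r ⟨hr.1, h⟩]
        · have e : clamp 0 s r = s := by simp [clamp, h, hs0]
          rw [e, mul_assoc, ← hbr r ⟨h, hr.2⟩]
          refine QuotientGroup.mk_mul_of_mem _ (QuotientGroup.eq.1 ?_)
          rw [hbr s ⟨le_rfl, hss'⟩, hat s ⟨hs0, le_rfl⟩]
  obtain ⟨a, h1, h2, h3⟩ := key n
  rw [hn n le_rfl] at h3
  exact ⟨a, h1, h2, h3⟩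

variable {H : Submodule ℝ E}

/-- Curves in `G ⧸ K` lift to curves whose logarithmic derivative is in an `Ad(K)`-invariant
complement of the Lie algebra of `K`. -/
theorem exists_horizontal_lift
    (hπ : IsSubmersion 𝓘(ℝ, E) 𝓘(ℝ, F) ∞ (QuotientGroup.mk : G → G ⧸ K))
    (hH : IsCompl (lieAlgModel E K) H) (hAd : ∀ y ∈ K, ∀ v ∈ H, adj E y v ∈ H)
    {β : ℝ → G ⧸ K} (hβ : LocAC F β) {a₀ : G} (h0 : (a₀ : G ⧸ K) = β 0) :
    ∃ a : ℝ → G, LocAC E a ∧ a 0 = a₀ ∧ (∀ t ∈ Icc (0 : ℝ) 1, (a t : G ⧸ K) = β t) ∧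
      ∀ᵐ t, t ∈ Ioo (0 : ℝ) 1 → logDeriv E a t ∈ H := by
  obtain ⟨a, ha, ha0, hat⟩ := exists_lift hπ hβ h0
  let P : E →L[ℝ] E := LinearMap.toContinuousLinearMap ((lieAlgModel E K).projection H hH)
  have hP : ∀ v, P v ∈ lieAlgModel E K := Submodule.projection_apply_mem hH
  have hP' : ∀ v, v - P v ∈ H := Submodule.sub_projection_mem hH
  have hint : Integrable ((Icc (0 : ℝ) 1).indicator (logDeriv E a)) :=
    ((ha.locallyIntegrable_logDeriv.integrableOn_isCompact isCompact_Icc).integrable_indicator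
      measurableSet_Icc)
  -- The correction `m` integrates the 𝔨-part of the logarithmic derivative. It stays in K, and
  -- dividing by it on the right removes that part up to Ad(m), which preserves `H`.
  obtain ⟨m, hm, hm0, hmlog⟩ := exists_locAC_of_logDeriv (P.integrable_comp hint) (1 : G)
  have hmK : ∀ t, m t ∈ K := fun t => by
    have := hm.mk_eq_of_logDeriv_mem hπ (hmlog.mono fun t ht => by
      rw [ht, indicator]; split_ifs; exacts [hP _, zero_mem _]) 0 t
    rw [hm0] at this
    simpa using QuotientGroup.eq.1 this
  refine ⟨fun t => a t * (m t)⁻¹, ha.mul hm.inv, by simp [ha0, hm0], fun t ht => ?_, ?_⟩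
  · rw [QuotientGroup.mk_mul_of_mem _ (K.inv_mem (hmK t)), hat t ht]
  · filter_upwards [ha.logDeriv_mul hm.inv, hm.logDeriv_inv, hmlog] with t h1 h2 h3 ht
    rw [h1, h2, h3, indicator_of_mem (Ioo_subset_Ioc_self ht),
      indicator_of_mem (Ioo_subset_Icc_self ht), inv_inv, ← sub_eq_add_neg, ← map_sub]
    exact hAd _ (hmK t) _ (hP' _)

/-- Two horizontal curves with the same projection differ by a constant element of `K`. -/
theorem eq_mul_of_horizontal
    (hπ : IsSubmersion 𝓘(ℝ, E) 𝓘(ℝ, F) ∞ (QuotientGroup.mk : G → G ⧸ K))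
    (hH : IsCompl (lieAlgModel E K) H) (hAd : ∀ y ∈ K, ∀ v ∈ H, adj E y v ∈ H)
    {a b : ℝ → G} (ha : LocAC E a) (hb : LocAC E b) (haH : ∀ᵐ t, logDeriv E a t ∈ H)
    (hbH : ∀ᵐ t, logDeriv E b t ∈ H) (hab : ∀ t, (a t : G ⧸ K) = b t) (s t : ℝ) :
    b t = a t * ((a s)⁻¹ * b s) := by
  have hk : LocAC E (fun t => (a t)⁻¹ * b t) := ha.inv.mul hb
  have hkK : ∀ t, (a t)⁻¹ * b t ∈ K := fun t => QuotientGroup.eq.1 (hab t)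
  -- For k = a⁻¹b in K the derivative lies in 𝔨, while the product rule writes it as -Ad(k⁻¹)(a⁻¹a')
  -- + b⁻¹b', an element of `H`.
  have h0 : ∀ᵐ t, logDeriv E (fun t => (a t)⁻¹ * b t) t = 0 := by
    filter_upwards [hk.logDeriv_mem_of_mem hπ hkK, ha.inv.logDeriv_mul hb, ha.logDeriv_inv, haH,
      hbH] with t h1 h2 h3 h4 h5
    refine Submodule.disjoint_def.1 hH.disjoint _ h1 ?_
    rw [h2, h3, map_neg, ← ContinuousLinearMap.comp_apply, ← adj_mul]
    refine H.add_mem (H.neg_mem (hAd _ ?_ _ h4)) h5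
    have := K.inv_mem (hkK t)
    rwa [mul_inv_rev, inv_inv] at this
  rw [hk.eq_of_logDeriv_eq_zero h0 s t, mul_inv_cancel_left]

end Lifts

/-! ### The invariant metric and the map Q -/

section MetricFacts

variable {E : Type*} [NormedAddCommGroup E] [NormedSpace ℝ E]
  {G : Type*} [TopologicalSpace G] [ChartedSpace E G] [Group G] [LieGroup 𝓘(ℝ, E) ∞ G]
  [RiemannianBundle (fun g : G => TangentSpace 𝓘(ℝ, E) g)] {K : Subgroup G}

/-- All tangent spaces share the model space `E`, but the inner product depends on the base point;
this moves it along identities such as g⁻¹g = 1. -/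
theorem inner_congr_base {g h : G} (e : g = h) (v w : E) :
    @inner ℝ (TangentSpace 𝓘(ℝ, E) g) _ v w = @inner ℝ (TangentSpace 𝓘(ℝ, E) h) _ v w := by
  subst e; rfl

theorem inner_toLieAlgebra (hleft : MetricLeftInvariant E G) (g : G)
    (v w : TangentSpace 𝓘(ℝ, E) g) :
    inner ℝ (toLieAlgebra g v) (toLieAlgebra g w) = inner ℝ v w :=
  (inner_congr_base (E := E) (inv_mul_cancel g).symm _ _).trans (hleft g⁻¹ g v w)

theorem norm_toLieAlgebra (hleft : MetricLeftInvariant E G) (g : G)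
    (v : TangentSpace 𝓘(ℝ, E) g) : ‖toLieAlgebra g v‖ = ‖v‖ := by
  rw [norm_eq_sqrt_real_inner, norm_eq_sqrt_real_inner (F := TangentSpace 𝓘(ℝ, E) g),
    inner_toLieAlgebra hleft]

/-- Conjugation by y is left translation by y followed by right translation by y⁻¹, both isometric.
-/
theorem inner_Ad (hleft : MetricLeftInvariant E G) (hright : MetricRightInvariant E K)
    {y : G} (hy : y ∈ K) (v w : TangentSpace 𝓘(ℝ, E) (1 : G)) :
    inner ℝ (Ad y v) (Ad y w) = inner ℝ v w := by
  have key : ∀ u : TangentSpace 𝓘(ℝ, E) (1 : G),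
      (Ad y u : E) = (dR (E := E) y⁻¹ (y * 1) (dL y 1 u) : E) := fun u =>
    congrArg (fun A : E →L[ℝ] E => A u) (tmap_comp (f := fun x : G => y * x)
      (g := fun x : G => x * y⁻¹) (mdifferentiableAt_mul_right (E := E) y⁻¹ (y * 1))
      (mdifferentiableAt_mul_left (E := E) y 1))
  have h1 := hright y⁻¹ (K.inv_mem hy) (y * 1) (dL y 1 v) (dL y 1 w)
  have h2 := hleft y 1 v w
  rw [← h2, ← h1]
  have e : y * 1 * y⁻¹ = 1 := by simp
  refine Eq.trans ?_ (inner_congr_base (E := E) e _ _).symm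
  exact congrArg₂ (fun a b : E => @inner ℝ (TangentSpace 𝓘(ℝ, E) (1 : G)) _ a b) (key v) (key w)

/-- The orthogonal complement of the Lie algebra of `K`, as a subspace of the model space. -/
def horModel (E : Type*) [NormedAddCommGroup E] [NormedSpace ℝ E]
    {G : Type*} [TopologicalSpace G] [ChartedSpace E G] [Group G] [LieGroup 𝓘(ℝ, E) ∞ G]
    [RiemannianBundle (fun g : G => TangentSpace 𝓘(ℝ, E) g)] (K : Subgroup G) : Submodule ℝ E :=
  (lieAlg (E := E) K)ᗮ

theorem Ad_mem_orthogonal (hleft : MetricLeftInvariant E G) (hright : MetricRightInvariant E K)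
    {y : G} (hy : y ∈ K) {v : TangentSpace 𝓘(ℝ, E) (1 : G)} (hv : v ∈ (lieAlg (E := E) K)ᗮ) :
    Ad y v ∈ (lieAlg (E := E) K)ᗮ := by
  rw [Submodule.mem_orthogonal] at hv ⊢
  intro u hu
  have h1 : Ad y⁻¹ u ∈ lieAlg (E := E) K := adj_mem_lieAlgModel (E := E) (K.inv_mem hy) hu
  have h2 : Ad y (Ad y⁻¹ u) = u := by
    have := adj_inv_adj (E := E) y⁻¹ u
    rwa [inv_inv] at this
  rw [← hv _ h1, ← inner_Ad hleft hright hy (Ad y⁻¹ u) v, h2]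

theorem adj_mem_horModel (hleft : MetricLeftInvariant E G) (hright : MetricRightInvariant E K)
    {y : G} (hy : y ∈ K) {v : E} (hv : v ∈ horModel E K) : adj E y v ∈ horModel E K :=
  Ad_mem_orthogonal (E := E) hleft hright hy hv

variable {F : Type*} [NormedAddCommGroup F] [NormedSpace ℝ F]
  [ChartedSpace F (G ⧸ K)] [IsManifold 𝓘(ℝ, F) ∞ (G ⧸ K)]

/-- Left trivialization is an isometry carrying the vertical space onto 𝔨, so it matches the
orthogonal complements. -/
theorem mem_vertical_orthogonal_iff (hleft : MetricLeftInvariant E G)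
    (hπ : IsSubmersion 𝓘(ℝ, E) 𝓘(ℝ, F) ∞ (QuotientGroup.mk : G → G ⧸ K)) (p : G)
    (v : TangentSpace 𝓘(ℝ, E) p) :
    v ∈ (vertical E F K p)ᗮ ↔ leftTriv E p v ∈ horModel E K := by
  have hvert : ∀ u : TangentSpace 𝓘(ℝ, E) p,
      u ∈ vertical E F K p ↔ toLieAlgebra p u ∈ lieAlg (E := E) K := fun u =>
    tmap_mk_eq_zero_iff hπ p u
  rw [Submodule.mem_orthogonal]
  refine Iff.trans ?_ (Submodule.mem_orthogonal (lieAlg (E := E) K) (toLieAlgebra p v)).symm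
  constructor
  · intro h u hu
    let x : TangentSpace 𝓘(ℝ, E) p := tmap E E (fun x : G => p * x) 1 u
    have hx : toLieAlgebra p x = u := leftTriv_tmap_mul_left (E := E) p u
    rw [← hx, inner_toLieAlgebra hleft]
    exact h x ((hvert x).2 (by rw [hx]; exact hu))
  · intro h u hu
    rw [← inner_toLieAlgebra hleft]
    exact h _ ((hvert u).1 hu)

theorem isHorizontal_iff (hleft : MetricLeftInvariant E G)
    (hπ : IsSubmersion 𝓘(ℝ, E) 𝓘(ℝ, F) ∞ (QuotientGroup.mk : G → G ⧸ K)) (α : AC E G) :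
    IsHorizontal F K α ↔ ∀ᵐ t ∂lebI, logDeriv E α.ext t ∈ horModel E K :=
  eventually_congr (.of_forall fun t =>
    mem_vertical_orthogonal_iff hleft hπ (α.ext t) (α.velocity t))

variable [FiniteDimensional ℝ E]

theorem isHorizontal_iff_ae (hleft : MetricLeftInvariant E G)
    (hπ : IsSubmersion 𝓘(ℝ, E) 𝓘(ℝ, F) ∞ (QuotientGroup.mk : G → G ⧸ K)) (α : AC E G) :
    IsHorizontal F K α ↔ ∀ᵐ t, logDeriv E α.ext t ∈ horModel E K := by
  rw [isHorizontal_iff hleft hπ, ae_lebI_iff]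
  refine eventually_congr (.of_forall fun t => ⟨fun h => ?_, fun h _ => h⟩)
  by_cases ht : t ∈ Icc (0 : ℝ) 1
  · exact h ht
  · rw [α.logDeriv_ext_eq_zero ht]; exact zero_mem _

instance finiteDimensional_tangentSpace_one :
    FiniteDimensional ℝ (TangentSpace 𝓘(ℝ, E) (1 : G)) := by
  assumption

theorem isCompl_horModel : IsCompl (lieAlgModel E K) (horModel E K) :=
  Submodule.isCompl_orthogonal (K := lieAlg (E := E) K)

variable (E G) in
/-- The identification of the model space with the Lie algebra. -/
def toLie : E ≃L[ℝ] TangentSpace 𝓘(ℝ, E) (1 : G) := ContinuousLinearEquiv.refl ℝ E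

/-- The logarithmic derivative of an absolutely continuous curve, as a curve in the Lie algebra. -/
def AC.lieDeriv (α : AC E G) (t : ℝ) : TangentSpace 𝓘(ℝ, E) (1 : G) :=
  toLie E G (logDeriv E α.ext t)

/-- Left invariance lets the norm be taken in 𝔤. The case α' = 0 needs no separate formula, as both
sides vanish. -/
theorem srv_eq (hleft : MetricLeftInvariant E G) (α : AC E G) (t : ℝ) :
    srv α t = (√‖α.lieDeriv t‖)⁻¹ • α.lieDeriv t := by
  have h1 : α.lieDeriv t = toLieAlgebra (α.ext t) (α.velocity t) := rfl
  unfold srv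
  split_ifs with h
  · rw [h1, h, map_zero, smul_zero]
  · rw [map_smul, h1, norm_toLieAlgebra hleft]

theorem AC.integrable_lieDeriv (α : AC E G) : Integrable α.lieDeriv lebI :=
  (toLie E G : E →L[ℝ] TangentSpace 𝓘(ℝ, E) (1 : G)).integrable_comp
    (α.locAC_ext.locallyIntegrable_logDeriv.integrableOn_isCompact isCompact_Icc)

section Vector

variable {V : Type*} [NormedAddCommGroup V] [InnerProductSpace ℝ V]

theorem norm_inv_sqrt_smul (v : V) : ‖(√‖v‖)⁻¹ • v‖ = √‖v‖ := by
  rw [norm_smul, norm_inv, Real.norm_of_nonneg (Real.sqrt_nonneg _)]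
  rcases eq_or_ne v 0 with rfl | h
  · simp
  · have := norm_pos_iff.2 h
    rw [inv_mul_eq_div, Real.div_sqrt]

/-- Together with `inv_sqrt_norm_smul_smul`, this makes v ↦ v/√‖v‖ and v ↦ ‖v‖v mutually inverse,
including at 0. -/
theorem norm_smul_inv_sqrt_smul (v : V) : ‖(√‖v‖)⁻¹ • v‖ • ((√‖v‖)⁻¹ • v) = v := by
  rw [norm_inv_sqrt_smul, smul_smul]
  rcases eq_or_ne v 0 with rfl | h
  · simp
  · rw [mul_inv_cancel₀ (Real.sqrt_pos.2 (norm_pos_iff.2 h)).ne', one_smul]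

theorem inv_sqrt_norm_smul_smul (v : V) : (√‖‖v‖ • v‖)⁻¹ • (‖v‖ • v) = v := by
  rw [norm_smul, norm_norm, Real.sqrt_mul_self (norm_nonneg v), smul_smul]
  rcases eq_or_ne v 0 with rfl | h
  · simp
  · rw [inv_mul_cancel₀ (norm_ne_zero_iff.2 h), one_smul]

end Vector

theorem AC.lieDeriv_eq (hleft : MetricLeftInvariant E G) (α : AC E G) (t : ℝ) :
    α.lieDeriv t = ‖srv α t‖ • srv α t := by
  rw [srv_eq hleft, norm_smul_inv_sqrt_smul]

/-- The square of ‖q‖ is the norm of the logarithmic derivative, which is integrable on [0,1]. -/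
theorem memLp_srv (hleft : MetricLeftInvariant E G) (α : AC E G) : MemLp (srv α) 2 lebI := by
  have he : srv α = fun t => (√‖α.lieDeriv t‖)⁻¹ • α.lieDeriv t := funext (srv_eq hleft α)
  have hm : AEStronglyMeasurable (srv α) lebI := by
    rw [he]
    have h := α.integrable_lieDeriv.aestronglyMeasurable
    exact ((Real.continuous_sqrt.measurable.comp_aemeasurable
      h.norm.aemeasurable).inv.aestronglyMeasurable).smul h
  rw [memLp_two_iff_integrable_sq_norm hm]
  refine α.integrable_lieDeriv.norm.congr (.of_forall fun t => ?_)
  simp only [srv_eq hleft, norm_inv_sqrt_smul, Real.sq_sqrt (norm_nonneg _)]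

theorem Q_eq (hleft : MetricLeftInvariant E G) (α : AC E G) :
    Q α = (α 0, (memLp_srv hleft α).toLp (srv α)) := by
  unfold Q; rw [dif_pos (memLp_srv hleft α)]

theorem Q_snd_ae (hleft : MetricLeftInvariant E G) (α : AC E G) :
    (Q α).2 =ᵐ[lebI] srv α := by
  rw [Q_eq hleft]; exact MemLp.coeFn_toLp (memLp_srv hleft α)

/-- The logarithmic derivative is recovered as ‖q‖q, and with α(0) it determines the curve. -/
theorem Q_injective (hleft : MetricLeftInvariant E G) :
    Function.Injective (Q : AC E G → G × L2 E G) := fun α α' h => by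
  have h0 : α 0 = α' 0 := congrArg Prod.fst h
  have h1 : ∀ᵐ t ∂lebI, α.lieDeriv t = α'.lieDeriv t := by
    have e := Q_snd_ae hleft α
    rw [h] at e
    filter_upwards [e, Q_snd_ae hleft α'] with t e1 e2
    rw [AC.lieDeriv_eq hleft, AC.lieDeriv_eq hleft, ← e1, ← e2]
  refine AC.eq_of_ext_eq (α.locAC_ext.eq_of_logDeriv_eq α'.locAC_ext (t₀ := (0 : unitInterval)) ?_
    (by rw [α.ext_coe, α'.ext_coe, h0]))
  rw [ae_lebI_iff] at h1
  filter_upwards [h1] with t ht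
  by_cases hmem : t ∈ Icc (0 : ℝ) 1
  · exact (toLie E G).injective (ht hmem)
  · rw [α.logDeriv_ext_eq_zero hmem, α'.logDeriv_ext_eq_zero hmem]

theorem LocAC.toAC_logDeriv {γ : ℝ → G} (h : LocAC E γ) {t : ℝ} (ht : t ∈ Ioo (0 : ℝ) 1) :
    logDeriv E h.toAC.ext t = logDeriv E γ t := logDeriv_congr (h.toAC_ext_eventuallyEq ht)

/-- The control ‖q‖q has norm ‖q‖², hence is integrable, and the curve driven by it has square root
velocity q. -/
theorem Q_surjective (hleft : MetricLeftInvariant E G) :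
    Function.Surjective (Q : AC E G → G × L2 E G) := by
  rintro ⟨g, q⟩
  have hq : MemLp q 2 lebI := Lp.memLp q
  have hw : Integrable (fun t => ‖q t‖ • q t) lebI := by
    refine Integrable.mono' ((memLp_two_iff_integrable_sq_norm hq.1).1 hq)
      (hq.1.norm.smul hq.1) (.of_forall fun t => ?_)
    rw [norm_smul, norm_norm, sq]
  set w : ℝ → E := (Icc (0 : ℝ) 1).indicator fun t => (toLie E G).symm (‖q t‖ • q t) with hwdef
  have hwint : Integrable w := by
    have h1 : Integrable (fun t => (toLie E G).symm (‖q t‖ • q t)) lebI :=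
      ((toLie E G).symm : TangentSpace 𝓘(ℝ, E) (1 : G) →L[ℝ] E).integrable_comp hw
    exact IntegrableOn.integrable_indicator h1 measurableSet_Icc
  obtain ⟨m, hm, hm0, hlog⟩ := exists_locAC_of_logDeriv hwint g
  refine ⟨hm.toAC, Prod.ext hm0 (Lp.ext ?_)⟩
  refine (Q_snd_ae hleft hm.toAC).trans (ae_lebI_of_Ioo ?_)
  filter_upwards [hlog] with t h1 ht
  have h2 : hm.toAC.lieDeriv t = ‖q t‖ • q t := by
    rw [AC.lieDeriv, hm.toAC_logDeriv ht, h1, indicator_of_mem (Ioo_subset_Ioc_self ht), hwdef,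
      indicator_of_mem (Ioo_subset_Icc_self ht), ContinuousLinearEquiv.apply_symm_apply]
  rw [srv_eq hleft, h2, inv_sqrt_norm_smul_smul]

/-- At each t, q and the logarithmic derivative are scalar multiples of each other, so they lie in
𝔨^⊥ together. -/
theorem isHorizontal_iff_Q (hleft : MetricLeftInvariant E G)
    (hπ : IsSubmersion 𝓘(ℝ, E) 𝓘(ℝ, F) ∞ (QuotientGroup.mk : G → G ⧸ K)) (α : AC E G) :
    IsHorizontal F K α ↔ (Q α).2 ∈ L2perp E K := by
  rw [isHorizontal_iff hleft hπ]
  have h : (Q α).2 ∈ L2perp E K ↔ ∀ᵐ t ∂lebI, (Q α).2 t ∈ (lieAlg (E := E) K)ᗮ := Iff.rfl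
  rw [h]
  refine eventually_congr ?_
  filter_upwards [Q_snd_ae hleft α] with t ht
  rw [ht]
  have e : logDeriv E α.ext t ∈ horModel E K ↔ α.lieDeriv t ∈ (lieAlg (E := E) K)ᗮ := Iff.rfl
  rw [e]
  refine ⟨fun h => ?_, fun h => ?_⟩
  · rw [srv_eq hleft]; exact Submodule.smul_mem _ _ h
  · rw [AC.lieDeriv_eq hleft]; exact Submodule.smul_mem _ _ h

/-! ### The action of `K` -/

theorem Ad_comp (y z : G) (v : TangentSpace 𝓘(ℝ, E) (1 : G)) :
    Ad (E := E) (y * z) v = Ad y (Ad z v) :=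
  congrArg (fun A : E →L[ℝ] E => A v) (adj_mul (E := E) y z)

theorem act_snd_ae (p : G × L2 E G) (y : G) :
    ∀ᵐ t ∂lebI, (act p y).2 t = Ad y⁻¹ (p.2 t) := by
  unfold act
  exact ContinuousLinearMap.coeFn_compLp _ _

theorem act_one (p : G × L2 E G) : act p 1 = p := by
  refine Prod.ext (mul_one p.1) (Lp.ext ?_)
  filter_upwards [act_snd_ae p 1] with t ht
  refine ht.trans ?_
  rw [inv_one]
  exact congrArg (fun A : E →L[ℝ] E => A (p.2 t)) (adj_one (E := E) (G := G))

theorem act_act (p : G × L2 E G) (y z : G) : act (act p y) z = act p (y * z) := by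
  refine Prod.ext (mul_assoc p.1 y z) (Lp.ext ?_)
  filter_upwards [act_snd_ae p y,
    act_snd_ae (act p y) z,
    act_snd_ae p (y * z)] with t h1 h2 h3
  refine h2.trans (Eq.trans ?_ h3.symm)
  rw [mul_inv_rev, Ad_comp]
  exact congrArg (Ad (E := E) z⁻¹) h1

theorem act_mem (hleft : MetricLeftInvariant E G) (hright : MetricRightInvariant E K)
    (p : G × L2 E G) {y : G} (hy : y ∈ K) (hp : p.2 ∈ L2perp E K) :
    (act p y).2 ∈ L2perp E K := by
  have hp' : ∀ᵐ t ∂lebI, p.2 t ∈ (lieAlg (E := E) K)ᗮ := hp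
  change ∀ᵐ t ∂lebI, (act p y).2 t ∈ (lieAlg (E := E) K)ᗮ
  filter_upwards [act_snd_ae p y, hp'] with t h1 h2
  have h3 : (act p y).2 t = Ad y⁻¹ (p.2 t) := h1
  rw [h3]
  exact adj_mem_horModel hleft hright (K.inv_mem hy) h2

/-- Right multiplication by y applies Ad(y⁻¹) to the logarithmic derivative; being isometric, it
commutes with division by the root of the norm. -/
theorem Q_mul (hleft : MetricLeftInvariant E G) (hright : MetricRightInvariant E K)
    {α α' : AC E G} {y : G} (hy : y ∈ K) (h : ∀ t, α' t = α t * y) : Q α' = act (Q α) y := by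
  refine Prod.ext (h 0) (Lp.ext ?_)
  have hl : ∀ᵐ t ∂lebI, α'.lieDeriv t = Ad y⁻¹ (α.lieDeriv t) := by
    refine ae_restrict_of_ae ?_
    filter_upwards [α.locAC_ext.ae_mdifferentiableAt] with t ht
    have e : α'.ext = fun s => α.ext s * y := funext fun s => h _
    rw [AC.lieDeriv, e, logDeriv_mul_const y ht]
    rfl
  filter_upwards [act_snd_ae (Q α) y, Q_snd_ae hleft α,
    Q_snd_ae hleft α', hl] with t h1 h2 h3 h4
  have hn : ‖α'.lieDeriv t‖ = ‖α.lieDeriv t‖ := by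
    rw [norm_eq_sqrt_real_inner, norm_eq_sqrt_real_inner, h4,
      inner_Ad hleft hright (K.inv_mem hy)]
  refine h3.trans (Eq.trans ?_ h1.symm)
  rw [h2, srv_eq hleft, srv_eq hleft, hn, h4, map_smul]

end MetricFacts

/-! ### Horizontal lifts and the quotient by K -/

section Main

variable {E : Type*} [NormedAddCommGroup E] [NormedSpace ℝ E] [FiniteDimensional ℝ E]
  {G : Type*} [TopologicalSpace G] [ChartedSpace E G] [Group G] [LieGroup 𝓘(ℝ, E) ∞ G]
  [RiemannianBundle (fun g : G => TangentSpace 𝓘(ℝ, E) g)] {K : Subgroup G}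
  {F : Type*} [NormedAddCommGroup F] [NormedSpace ℝ F] [FiniteDimensional ℝ F]
  [ChartedSpace F (G ⧸ K)] [IsManifold 𝓘(ℝ, F) ∞ (G ⧸ K)]

theorem existsUnique_horizontalLift
    (hleft : MetricLeftInvariant E G) (hright : MetricRightInvariant E K)
    (hπ : IsSubmersion 𝓘(ℝ, E) 𝓘(ℝ, F) ∞ (QuotientGroup.mk : G → G ⧸ K))
    (β : AC F (G ⧸ K)) (a : G) (ha : (QuotientGroup.mk a : G ⧸ K) = β 0) :
    ∃! α : AC E G, IsHorizontalLift F K α β ∧ α 0 = a := by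
  have hAd : ∀ y ∈ K, ∀ v ∈ horModel E K, adj E y v ∈ horModel E K :=
    fun y hy v hv => adj_mem_horModel hleft hright hy hv
  obtain ⟨m, hm, hm0, hmβ, hmH⟩ := exists_horizontal_lift hπ isCompl_horModel hAd β.locAC_ext
    (a₀ := a) (by rw [ha, ← β.ext_coe]; rfl)
  refine ⟨hm.toAC, ⟨⟨?_, fun t => ?_⟩, hm0⟩, ?_⟩
  · rw [isHorizontal_iff hleft hπ]
    refine ae_lebI_of_Ioo ?_
    filter_upwards [hmH] with t ht htI
    rw [hm.toAC_logDeriv htI]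
    exact ht htI
  · exact (hmβ t t.2).trans (β.ext_coe t)
  · rintro α ⟨⟨hα, hαβ⟩, hα0⟩
    have hm' : ∀ᵐ t, logDeriv E hm.toAC.ext t ∈ horModel E K := by
      rw [← isHorizontal_iff_ae hleft hπ, isHorizontal_iff hleft hπ]
      refine ae_lebI_of_Ioo ?_
      filter_upwards [hmH] with t ht htI
      rw [hm.toAC_logDeriv htI]
      exact ht htI
    refine AC.eq_of_ext_eq (funext fun t => ?_)
    have h := eq_mul_of_horizontal hπ isCompl_horModel hAd hm.toAC.locAC_ext α.locAC_ext hm'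
      ((isHorizontal_iff_ae hleft hπ α).1 hα) (fun s => ?_) ((0 : unitInterval) : ℝ) t
    · have e : hm.toAC 0 = a := hm0
      rwa [AC.ext_coe, AC.ext_coe, hα0, e, inv_mul_cancel, mul_one] at h
    · have h1 : (QuotientGroup.mk (α.ext s) : G ⧸ K) = β (projIcc 0 1 zero_le_one s) := hαβ _
      have h2 : (QuotientGroup.mk (hm.toAC.ext s) : G ⧸ K) = β.ext (clamp 0 1 s) :=
        hmβ _ (clamp_mem zero_le_one s)
      rw [h1, h2, ← coe_projIcc_eq_clamp, AC.ext_coe]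

theorem horizontalLift_eq_mul
    (hleft : MetricLeftInvariant E G) (hright : MetricRightInvariant E K)
    (hπ : IsSubmersion 𝓘(ℝ, E) 𝓘(ℝ, F) ∞ (QuotientGroup.mk : G → G ⧸ K))
    {β : AC F (G ⧸ K)} {α α' : AC E G} (h : IsHorizontalLift F K α β)
    (h' : IsHorizontalLift F K α' β) :
    (α 0)⁻¹ * α' 0 ∈ K ∧ (∀ t, α' t = α t * ((α 0)⁻¹ * α' 0)) ∧
      Q α' = act (Q α) ((α 0)⁻¹ * α' 0) := by
  have hy : (α 0)⁻¹ * α' 0 ∈ K := QuotientGroup.eq.1 ((h.2 0).trans (h'.2 0).symm)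
  have hmul : ∀ t, α' t = α t * ((α 0)⁻¹ * α' 0) := fun t => by
    have := eq_mul_of_horizontal hπ isCompl_horModel
      (fun y hy v hv => adj_mem_horModel hleft hright hy hv) α.locAC_ext α'.locAC_ext
      ((isHorizontal_iff_ae hleft hπ α).1 h.1) ((isHorizontal_iff_ae hleft hπ α').1 h'.1)
      (fun s => (h.2 _).trans (h'.2 _).symm) ((0 : unitInterval) : ℝ) t
    simpa only [AC.ext_coe] using this
  exact ⟨hy, hmul, Q_mul hleft hright hy hmul⟩

/-- The projection to `G ⧸ K` of an absolutely continuous curve. -/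
def AC.proj (hπ : IsSubmersion 𝓘(ℝ, E) 𝓘(ℝ, F) ∞ (QuotientGroup.mk : G → G ⧸ K))
    (α : AC E G) : AC F (G ⧸ K) :=
  ⟨fun t => (α t : G ⧸ K), LocAC.isAC (α.locAC_ext.mk hπ)⟩

/-- The curve in `G` with given initial value and square root velocity. -/
def invQ (hleft : MetricLeftInvariant E G) (p : G × L2 E G) : AC E G :=
  Classical.choose (Q_surjective hleft p)

theorem Q_invQ (hleft : MetricLeftInvariant E G) (p : G × L2 E G) : Q (invQ hleft p) = p :=
  Classical.choose_spec (Q_surjective hleft p)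

theorem invQ_Q (hleft : MetricLeftInvariant E G) (α : AC E G) : invQ hleft (Q α) = α :=
  Q_injective hleft (Q_invQ hleft (Q α))

/-- The curve α·y is absolutely continuous with Q-data (Q α) ∗ y, and Q is injective. -/
theorem invQ_act (hleft : MetricLeftInvariant E G) (hright : MetricRightInvariant E K)
    (p : G × L2 E G) {y : G} (hy : y ∈ K) (t : unitInterval) :
    invQ hleft (act p y) t = invQ hleft p t * y := by
  set α := invQ hleft p with hα
  have hAC : LocAC E (fun s => α.ext s * y) := α.locAC_ext.mul (locAC_const y)
  have hval : ∀ s, hAC.toAC s = α s * y := fun s => by rw [hAC.toAC_apply, α.ext_coe]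
  have h := Q_mul hleft hright hy hval
  rw [show Q α = p from Q_invQ hleft p] at h
  rw [← h, invQ_Q, hval]

theorem exists_bijective_quotientByK
    (hleft : MetricLeftInvariant E G) (hright : MetricRightInvariant E K)
    (hπ : IsSubmersion 𝓘(ℝ, E) 𝓘(ℝ, F) ∞ (QuotientGroup.mk : G → G ⧸ K)) :
    ∃ Φ : QuotientByK E K → AC F (G ⧸ K), Function.Bijective Φ ∧
      ∀ (α : AC E G) (p : G × L2perp E K), IsHorizontal F K α →
        Q α = (p.1, (p.2 : L2 E G)) →
        ∀ t, Φ (Quot.mk _ p) t = (QuotientGroup.mk (α t) : G ⧸ K) := by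
  let Φ₀ : G × L2perp E K → AC F (G ⧸ K) := fun p => (invQ hleft (p.1, (p.2 : L2 E G))).proj hπ
  have hhor : ∀ p : G × L2perp E K, IsHorizontal F K (invQ hleft (p.1, (p.2 : L2 E G))) :=
    fun p => by rw [isHorizontal_iff_Q hleft hπ, Q_invQ]; exact p.2.2
  have hΦ₀ : ∀ p p' : G × L2perp E K,
      (∃ y ∈ K, ((p'.1, (p'.2 : L2 E G)) = act (p.1, (p.2 : L2 E G)) y)) → Φ₀ p = Φ₀ p' := by
    rintro p p' ⟨y, hy, h⟩
    refine Subtype.ext (funext fun t => QuotientGroup.eq.2 ?_)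
    rw [h, invQ_act hleft hright _ hy, inv_mul_cancel_left]
    exact hy
  refine ⟨Quot.lift Φ₀ hΦ₀, ⟨?_, fun β => ?_⟩, fun α p _ hp t => ?_⟩
  -- Curves with the same projection are horizontal lifts of one β, so their data differ by one
  -- element of K, which is the defining relation itself.
  · rintro ⟨p⟩ ⟨p'⟩ h
    have h1 : Φ₀ p = Φ₀ p' := h
    obtain ⟨hy, -, hQ⟩ := horizontalLift_eq_mul hleft hright hπ (β := Φ₀ p)
      (α := invQ hleft (p.1, (p.2 : L2 E G))) (α' := invQ hleft (p'.1, (p'.2 : L2 E G)))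
      ⟨hhor p, fun t => rfl⟩ ⟨hhor p', fun t => by rw [h1]; rfl⟩
    rw [Q_invQ, Q_invQ] at hQ
    exact Quot.sound ⟨_, hy, hQ⟩
  · obtain ⟨a, ha⟩ := QuotientGroup.mk_surjective (β 0)
    obtain ⟨α, ⟨⟨hα, hαβ⟩, -⟩, -⟩ := existsUnique_horizontalLift hleft hright hπ β a ha
    refine ⟨Quot.mk _ ((Q α).1, ⟨(Q α).2, (isHorizontal_iff_Q hleft hπ α).1 hα⟩), ?_⟩
    refine Subtype.ext (funext fun t => ?_)
    change ((invQ hleft (Q α)) t : G ⧸ K) = β t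
    rw [invQ_Q, hαβ]
  · change ((invQ hleft (p.1, (p.2 : L2 E G))) t : G ⧸ K) = _
    rw [← hp, invQ_Q]

end Main

end HomSRV

end

theorem mainTheorem2
    {E : Type*} [NormedAddCommGroup E] [NormedSpace ℝ E] [FiniteDimensional ℝ E]
    {G : Type*} [TopologicalSpace G] [T2Space G] [ChartedSpace E G] [Group G]
    [LieGroup 𝓘(ℝ, E) ∞ G]
    [RiemannianBundle (fun g : G => TangentSpace 𝓘(ℝ, E) g)]
    [IsContMDiffRiemannianBundle 𝓘(ℝ, E) ∞ E (fun g : G => TangentSpace 𝓘(ℝ, E) g)]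
    (K : Subgroup G) (hK : IsCompact (K : Set G))
    (hleft : HomSRV.MetricLeftInvariant E G) (hright : HomSRV.MetricRightInvariant E K)
    {F : Type*} [NormedAddCommGroup F] [NormedSpace ℝ F] [FiniteDimensional ℝ F]
    [ChartedSpace F (G ⧸ K)] [IsManifold 𝓘(ℝ, F) ∞ (G ⧸ K)]
    -- the smooth structure of `M = G/K` is the quotient one
    (hπ : IsSubmersion 𝓘(ℝ, E) 𝓘(ℝ, F) ∞ (QuotientGroup.mk : G → G ⧸ K)) :
    -- `Q` is well defined: `q` is square integrable for every absolutely continuous `α`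
    (∀ α : HomSRV.AC E G, MemLp (HomSRV.srv α) 2 HomSRV.lebI) ∧
    -- `Q` restricts to a bijection `AC^⊥([0,1], G) → G × L²([0,1], 𝔨^⊥)`
    BijOn (HomSRV.Q (E := E) (G := G)) {α | HomSRV.IsHorizontal F K α}
      {p | p.2 ∈ HomSRV.L2perp E K} ∧
    -- existence and uniqueness of horizontal lifts
    (∀ (β : HomSRV.AC F (G ⧸ K)) (a : G), (QuotientGroup.mk a : G ⧸ K) = β 0 →
      ∃! α : HomSRV.AC E G, HomSRV.IsHorizontalLift F K α β ∧ α 0 = a) ∧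
    -- two lifts differ by right multiplication by an element of `K`, which acts on the `Q`-data
    (∀ (β : HomSRV.AC F (G ⧸ K)) (α α' : HomSRV.AC E G),
      HomSRV.IsHorizontalLift F K α β → HomSRV.IsHorizontalLift F K α' β →
      (α 0)⁻¹ * α' 0 ∈ K ∧ (∀ t, α' t = α t * ((α 0)⁻¹ * α' 0)) ∧
        HomSRV.Q α' = HomSRV.act (HomSRV.Q α) ((α 0)⁻¹ * α' 0)) ∧
    -- `∗` is a right action of `K` on `G × L²([0,1], 𝔨^⊥)`
    ((∀ p : G × HomSRV.L2 E G, HomSRV.act p 1 = p) ∧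
      (∀ (p : G × HomSRV.L2 E G), ∀ y ∈ K, ∀ z ∈ K,
        HomSRV.act (HomSRV.act p y) z = HomSRV.act p (y * z)) ∧
      (∀ (p : G × HomSRV.L2 E G), ∀ y ∈ K, p.2 ∈ HomSRV.L2perp E K →
        (HomSRV.act p y).2 ∈ HomSRV.L2perp E K)) ∧
    -- `Q` induces a bijection `(G × L²([0,1], 𝔨^⊥)) / K → AC([0,1], M)`
    (∃ Φ : HomSRV.QuotientByK E K → HomSRV.AC F (G ⧸ K),
      Function.Bijective Φ ∧
      ∀ (α : HomSRV.AC E G) (p : G × HomSRV.L2perp E K), HomSRV.IsHorizontal F K α →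
        HomSRV.Q α = (p.1, (p.2 : HomSRV.L2 E G)) →
        ∀ t, Φ (Quot.mk _ p) t = (QuotientGroup.mk (α t) : G ⧸ K)) := by
  refine ⟨HomSRV.memLp_srv hleft, ⟨fun α hα => ?_, (HomSRV.Q_injective hleft).injOn, fun p hp => ?_⟩,
    HomSRV.existsUnique_horizontalLift hleft hright hπ,
    fun β α α' h h' => HomSRV.horizontalLift_eq_mul hleft hright hπ h h',
    ⟨HomSRV.act_one, fun p y _ z _ => HomSRV.act_act p y z,
      fun p y hy hp => HomSRV.act_mem hleft hright p hy hp⟩,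
    HomSRV.exists_bijective_quotientByK hleft hright hπ⟩
  · exact (HomSRV.isHorizontal_iff_Q hleft hπ α).1 hα
  · obtain ⟨α, rfl⟩ := HomSRV.Q_surjective hleft p
    exact ⟨α, (HomSRV.isHorizontal_iff_Q hleft hπ α).2 hp, rfl⟩
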